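/- **Setting.** A toric fan is a subdivision of the plane $\mathbb{R}^2$ into finitely many angles, each less than $\pi$. Let $u_0,\dots,u_{n-1}$ be nonzero vectors on its edges, listed counterclockwise, with indices modulo $n$; let $\sigma_i$ be the angle between $u_i$ and $u_{i+1}$. The toric domain $X$ of the fan is the compactification of $\mathbb{R}^2$ given by the nonnegative real part of the toric variety: the quotient of the set of those $x\in[0,\infty)^n$ whose vanishing coordinates are indexed by edges of one common angle, by the group $\{c\in\mathbb{R}^n:\sum_j c_ju_j=0\}$ acting by $x_j\mapsto e^{-c_j}x_j$. The vector $t=\sum_j c_ju_j\in\mathbb{R}^2$ acts on $X$ by $x_j\mapsto e^{-c_j}x_j$. The angle $\sigma_i$ corresponds to a fixed point (vertex) $v_i$, given by $x_i=x_{i+1}=0$. Let $E\to X$ be a continuous $\mathbb{R}^2$-equivariant real vector bundle of rank $k$. Assume that at every vertex $v_i$ the action is diagonal and linear in a local chart: $E_{v_i}$ is a direct sum of characters $t\mapsto e^{\langle p,t\rangle}$ with $p$ in a multiset $S_i=\{p_{i,1},\dots,p_{i,k}\}\subset\mathbb{R}^2$ (the dual plane is identified with $\mathbb{R}^2$ by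 the standard scalar product), and each weight vector of $E_{v_i}$ with character $p$ extends to a continuous section $s$ of $E$ over a neighbourhood $N$ of $v_i$ such that $t\cdot s(x)=e^{\langle p,t\rangle}s(t\cdot x)$ whenever $x,\,t\cdot x\in N$. *Invariant Euler characteristic.* Let $\mathcal{F}$ be the sheaf on the orbit space $X/\mathbb{R}^2$ (quotient topology) that assigns to an invariant open subset of $X$ the real vector space of continuous $\mathbb{R}^2$-invariant sections of $E$ over it. Put $$\chi^{\mathrm{inv}}(E)=\sum_m(-1)^m\dim_{\mathbb{R}}H^m(X/\mathbb{R}^2,\mathcal{F}).$$ *Characteristic curve.* A matching is a family of bijections $S_i\to S_{i+1}$ (of multisets), $i\in\mathbb{Z}/n$, such that corresponding characters $p,q$ satisfy $\langle p,u_{i+1}\rangle=\langle q,u_{i+1}\rangle$. The characteristic curve is the closed piecewise linear $1$-chain made of the oriented segments from $p$ to $q$ for all corresponding pairs; each segment is orthogonal to an edge of the fan. For $\varepsilon>0$ the deformed curve is obtained as follows. The character $p\in S_i$ is the intersection point of a line orthogonal to $u_i$ and a line orthogonal to $u_{i+1}$; each of these lines that passes through $0$, that is $\langle\cdot,u_j\rangle=0$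 with $j\in\{i,i+1\}$, is replaced by the parallel line $\langle\cdot,u_j\rangle=-\varepsilon$, and $p$ is replaced by the new intersection point. (The deformed line passes $0$ counterclockwise when it is traversed in the direction of $u_j$ turned by $-90^\circ$.) **Lemma 4.13.** All spaces $H^m(X/\mathbb{R}^2,\mathcal{F})$ are finite-dimensional, and they vanish for large $m$. Matchings exist, and for every matching: 1. if the characteristic curve does not pass through $0$, its index (winding number) around $0$ equals $\chi^{\mathrm{inv}}(E)$; 2. in general, for all sufficiently small $\varepsilon>0$, the index around $0$ of the deformed characteristic curve equals $\chi^{\mathrm{inv}}(E)$. -/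

import Mathlib

open CategoryTheory TopologicalSpace Topology Filter Bundle

noncomputable section

namespace ToricMorse

/-! ### The plane -/

/-- The plane `ℝ²`; it is both the plane of the fan (the acting group) and, through the standard
scalar product, the dual plane in which the characters live. -/
abbrev Plane : Type := ℝ × ℝ

/-- The standard scalar product; it pairs a character with an element of the group `ℝ²`. -/
def dot (p t : Plane) : ℝ := p.1 * t.1 + p.2 * t.2

/-- The oriented area `det (v, w)`. -/
def cross (v w : Plane) : ℝ := v.1 * w.2 - v.2 * w.1

/-- A point of the plane as a complex number. -/
def toComplex (p : Plane) : ℂ := ⟨p.1, p.2⟩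

/-! ### Toric fans -/

/-- A two-dimensional toric fan with `n` edges, listed counterclockwise: a subdivision of the plane
into the angles spanned by `ray i` and `ray (i + 1)`, indices being cyclic. Each angle is positive
and less than `π`, and each nonzero vector lies in exactly one of the angles (an angle is taken
with its first edge and without its second one). -/
structure ToricFan (n : ℕ) [NeZero n] where
  /-- a nonzero vector on each edge of the fan -/
  ray : Fin n → Plane
  cross_pos : ∀ i, 0 < cross (ray i) (ray (i + 1))
  cover : ∀ w : Plane, w ≠ 0 →
    ∃! i, ∃ a b : ℝ, 0 < a ∧ 0 ≤ b ∧ w = a • ray i + b • ray (i + 1)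

namespace ToricFan

variable {n : ℕ} [NeZero n] (Φ : ToricFan n)

/-! ### The toric domain

It is the nonnegative real part of the toric variety of the fan, written as a quotient in
homogeneous coordinates (one for each edge of the fan). -/

/-- Points with nonnegative homogeneous coordinates such that the coordinates that vanish belong to
edges of one common angle of the fan. -/
def HomogCoord (_ : ToricFan n) : Type :=
  {x : Fin n → ℝ // (∀ j, 0 ≤ x j) ∧ ∃ i, ∀ j, x j = 0 → j = i ∨ j = i + 1}

instance : TopologicalSpace Φ.HomogCoord :=
  inferInstanceAs (TopologicalSpace
    {x : Fin n → ℝ // (∀ j, 0 ≤ x j) ∧ ∃ i, ∀ j, x j = 0 → j = i ∨ j = i + 1})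

/-- Rescaling of the homogeneous coordinates by the positive numbers `exp (-c j)`. -/
def rescale (c : Fin n → ℝ) (x : Φ.HomogCoord) : Φ.HomogCoord :=
  ⟨fun j => Real.exp (-c j) * x.1 j,
    fun j => mul_nonneg (Real.exp_pos _).le (x.2.1 j), by
      obtain ⟨i, hi⟩ := x.2.2
      refine ⟨i, fun j hj => hi j ?_⟩
      exact (mul_eq_zero.1 hj).resolve_left (Real.exp_pos _).ne'⟩

theorem rescale_zero (x : Φ.HomogCoord) : Φ.rescale 0 x = x := by
  apply Subtype.ext; funext j; simp [rescale]

theorem rescale_add (c d : Fin n → ℝ) (x : Φ.HomogCoord) :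
    Φ.rescale (c + d) x = Φ.rescale c (Φ.rescale d x) := by
  apply Subtype.ext; funext j
  simp only [rescale, Pi.add_apply, neg_add, Real.exp_add]; ring

/-- The linear map from `ℝⁿ` to the plane that sends the basis vectors to the edges. -/
def total (c : Fin n → ℝ) : Plane := ∑ j, c j • Φ.ray j

theorem total_add (c d : Fin n → ℝ) : Φ.total (c + d) = Φ.total c + Φ.total d := by
  simp [total, add_smul, Finset.sum_add_distrib]

theorem total_neg (c : Fin n → ℝ) : Φ.total (-c) = -Φ.total c := by
  simp [total]

theorem total_zero : Φ.total 0 = 0 := by simp [total]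

/-- Two systems of homogeneous coordinates define the same point when they differ by a rescaling
from the kernel of `total`. -/
def homogSetoid : Setoid Φ.HomogCoord where
  r x y := ∃ c : Fin n → ℝ, Φ.total c = 0 ∧ y = Φ.rescale c x
  iseqv :=
    { refl := fun x => ⟨0, Φ.total_zero, (Φ.rescale_zero x).symm⟩
      symm := by
        rintro x y ⟨c, hc, rfl⟩
        refine ⟨-c, by rw [total_neg, hc, neg_zero], ?_⟩
        rw [← rescale_add, neg_add_cancel, rescale_zero]
      trans := by
        rintro x y z ⟨c, hc, rfl⟩ ⟨d, hd, rfl⟩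
        refine ⟨d + c, by rw [total_add, hc, hd, add_zero], ?_⟩
        rw [rescale_add] }

/-- The toric domain of the fan, with the quotient topology. -/
def Domain : Type := Quotient Φ.homogSetoid

instance : TopologicalSpace Φ.Domain :=
  inferInstanceAs (TopologicalSpace (Quotient Φ.homogSetoid))

/-- The point with given homogeneous coordinates. -/
def point (x : Φ.HomogCoord) : Φ.Domain := Quotient.mk Φ.homogSetoid x

/-- A linear section of `total`, supported on the first angle of the fan. -/
def lift (t : Plane) : Fin n → ℝ :=
  Pi.single 0 (cross t (Φ.ray (0 + 1)) / cross (Φ.ray 0) (Φ.ray (0 + 1))) +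
    Pi.single (0 + 1) (cross (Φ.ray 0) t / cross (Φ.ray 0) (Φ.ray (0 + 1)))

theorem lift_add (s t : Plane) : Φ.lift (s + t) = Φ.lift s + Φ.lift t := by
  have h1 : ∀ a b : ℝ, (Pi.single (0 : Fin n) (a + b) : Fin n → ℝ)
      = Pi.single 0 a + Pi.single 0 b := fun a b => Pi.single_add _ _ _
  have h2 : ∀ a b : ℝ, (Pi.single (0 + 1 : Fin n) (a + b) : Fin n → ℝ)
      = Pi.single (0 + 1) a + Pi.single (0 + 1) b := fun a b => Pi.single_add _ _ _
  have e1 : cross (s + t) (Φ.ray (0 + 1)) = cross s (Φ.ray (0 + 1)) + cross t (Φ.ray (0 + 1)) := by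
    simp only [cross, Prod.fst_add, Prod.snd_add]; ring
  have e2 : cross (Φ.ray 0) (s + t) = cross (Φ.ray 0) s + cross (Φ.ray 0) t := by
    simp only [cross, Prod.fst_add, Prod.snd_add]; ring
  rw [lift, e1, e2, add_div, add_div, h1, h2, lift, lift]; abel

theorem lift_zero : Φ.lift 0 = 0 := by
  have := Φ.lift_add 0 0
  rw [add_zero] at this
  exact left_eq_add.1 this

theorem total_lift (t : Plane) : Φ.total (Φ.lift t) = t := by
  have hD := (Φ.cross_pos 0).ne'
  have : Φ.total (Φ.lift t) =
      (cross t (Φ.ray (0 + 1)) / cross (Φ.ray 0) (Φ.ray (0 + 1))) • Φ.ray 0 +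
      (cross (Φ.ray 0) t / cross (Φ.ray 0) (Φ.ray (0 + 1))) • Φ.ray (0 + 1) := by
    rw [lift, total_add]
    congr 1 <;> simp [total, Pi.single_apply, ite_smul]
  rw [this]
  generalize Φ.ray (0 + 1) = v at *
  generalize Φ.ray 0 = u at *
  ext <;> simp only [Prod.fst_add, Prod.snd_add, Prod.smul_fst, Prod.smul_snd, smul_eq_mul] <;>
    field_simp <;> simp only [cross] <;> ring

/-- The action of `ℝ²`: the vector `t = ∑ c j • ray j` multiplies the coordinate `x j` by
`exp (-c j)`. So `x j` tends to zero along the flow in the direction of the edge `ray j`, and the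
flow in a direction inside an angle of the fan ends in the vertex of that angle. -/
instance : AddAction Plane Φ.Domain where
  vadd t := Quotient.map' (s₁ := Φ.homogSetoid) (s₂ := Φ.homogSetoid) (Φ.rescale (Φ.lift t)) (by
    rintro x y ⟨c, hc, rfl⟩
    exact ⟨c, hc, by rw [← rescale_add, ← rescale_add, add_comm]⟩)
  zero_vadd := by
    rintro ⟨x⟩
    change Φ.point (Φ.rescale (Φ.lift 0) x) = Φ.point x
    rw [lift_zero, rescale_zero]
  add_vadd := by
    rintro s t ⟨x⟩
    change Φ.point (Φ.rescale (Φ.lift (s + t)) x) = Φ.point (Φ.rescale (Φ.lift s) (Φ.rescale (Φ.lift t) x))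
    rw [lift_add, rescale_add]

/-- The description of the action does not depend on how `t` is written in terms of the edges. -/
theorem vadd_point (c : Fin n → ℝ) (x : Φ.HomogCoord) :
    Φ.total c +ᵥ Φ.point x = Φ.point (Φ.rescale c x) := by
  change Φ.point (Φ.rescale (Φ.lift (Φ.total c)) x) = _
  refine Quotient.sound (s := Φ.homogSetoid) ⟨c - Φ.lift (Φ.total c), ?_, ?_⟩
  · rw [sub_eq_add_neg, total_add, total_neg, total_lift, add_neg_cancel]
  · rw [← rescale_add, sub_add_cancel]

/-- The vertex of the toric domain that corresponds to the angle between `ray i` and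
`ray (i + 1)`. -/
def vertex (i : Fin n) : Φ.Domain :=
  Φ.point ⟨fun j => if j = i ∨ j = i + 1 then 0 else 1,
    fun j => by dsimp only; split_ifs <;> norm_num,
    i, fun j hj => by
      by_contra h
      simp [h] at hj⟩

/-- The space of orbits of the toric domain, with the quotient topology: its open sets are the
invariant open sets of the toric domain. -/
def OrbitSpace : Type := AddAction.orbitRel.Quotient Plane Φ.Domain

instance : TopologicalSpace Φ.OrbitSpace :=
  inferInstanceAs (TopologicalSpace (Quotient (AddAction.orbitRel Plane Φ.Domain)))

/-- The orbit of a point. -/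
def orbit (x : Φ.Domain) : Φ.OrbitSpace :=
  Quotient.mk (AddAction.orbitRel Plane Φ.Domain) x

theorem continuous_orbit : Continuous Φ.orbit := continuous_quotient_mk'

theorem orbit_vadd (t : Plane) (x : Φ.Domain) : Φ.orbit (t +ᵥ x) = Φ.orbit x :=
  Quotient.sound (s := AddAction.orbitRel Plane Φ.Domain) ⟨t, rfl⟩

end ToricFan

/-! ### Equivariant vector bundles -/

section Bundles

variable {n : ℕ} [NeZero n] (Φ : ToricFan n) {k : ℕ}
  (E : Φ.Domain → Type) [∀ x, AddCommGroup (E x)] [∀ x, Module ℝ (E x)]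
  [∀ x, TopologicalSpace (E x)] [TopologicalSpace (TotalSpace (Fin k → ℝ) E)]

/-- A continuous action of `ℝ²` on the total space of a vector bundle over a toric domain, linear on
the fibres and compatible with the action on the base. -/
structure EquivariantStructure where
  /-- the action of `t`, as a linear map from the fibre over `x` to the fibre over `t +ᵥ x` -/
  act : ∀ (t : Plane) (x : Φ.Domain), E x →ₗ[ℝ] E (t +ᵥ x)
  act_zero : ∀ (x : Φ.Domain) (e : E x),
    (⟨(0 : Plane) +ᵥ x, act 0 x e⟩ : TotalSpace (Fin k → ℝ) E) = ⟨x, e⟩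
  act_add : ∀ (s t : Plane) (x : Φ.Domain) (e : E x),
    (⟨(s + t) +ᵥ x, act (s + t) x e⟩ : TotalSpace (Fin k → ℝ) E) =
      ⟨s +ᵥ (t +ᵥ x), act s (t +ᵥ x) (act t x e)⟩
  continuous_act : Continuous fun q : Plane × TotalSpace (Fin k → ℝ) E =>
    (⟨q.1 +ᵥ q.2.proj, act q.1 q.2.proj q.2.snd⟩ : TotalSpace (Fin k → ℝ) E)

variable {Φ E}

namespace EquivariantStructure

/-- The vector `e` of the fibre over the vertex `v i` is a weight vector with character `p`: the
element `t` of `ℝ²` multiplies it by `exp ⟨p, t⟩`. -/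
def IsWeightVector (A : EquivariantStructure (k := k) Φ E) (i : Fin n) (p : Plane)
    (e : E (Φ.vertex i)) : Prop :=
  ∀ t : Plane, (⟨t +ᵥ Φ.vertex i, A.act t (Φ.vertex i) e⟩ : TotalSpace (Fin k → ℝ) E) =
    ⟨Φ.vertex i, Real.exp (dot p t) • e⟩

/-- The fibre over the vertex `v i` is the direct sum of one-dimensional representations with
characters `p 1, …, p k`. -/
def HasCharacters (A : EquivariantStructure (k := k) Φ E) (i : Fin n) (p : Fin k → Plane) : Prop :=
  ∃ b : Module.Basis (Fin k) ℝ (E (Φ.vertex i)), ∀ j, A.IsWeightVector i (p j) (b j)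

/-- The action on the bundle is linear in a local chart at the vertex `v i`: each weight vector at
the vertex extends to a continuous section over a neighbourhood of the vertex on which `ℝ²` acts
through the same character. -/
def IsLinearizableAt (A : EquivariantStructure (k := k) Φ E) (i : Fin n) : Prop :=
  ∀ (p : Plane) (e : E (Φ.vertex i)), A.IsWeightVector i p e →
    ∃ N ∈ 𝓝 (Φ.vertex i), ∃ s : ∀ x, E x,
      s (Φ.vertex i) = e ∧
      ContinuousOn (fun x => (⟨x, s x⟩ : TotalSpace (Fin k → ℝ) E)) N ∧
      ∀ (t : Plane) (x : Φ.Domain), x ∈ N → t +ᵥ x ∈ N →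
        A.act t x (s x) = Real.exp (dot p t) • s (t +ᵥ x)

end EquivariantStructure

/-! ### Invariant sections and the invariant Euler characteristic -/

variable [FiberBundle (Fin k → ℝ) E] [VectorBundle ℝ (Fin k → ℝ) E]

theorem continuous_section_iff {V : Set Φ.Domain} (s : ∀ x : V, E x) :
    Continuous (fun x : V => (⟨x, s x⟩ : TotalSpace (Fin k → ℝ) E)) ↔
      ∀ x₀ : V, ContinuousAt (fun x : V =>
        (trivializationAt (Fin k → ℝ) E (x₀ : Φ.Domain)).continuousLinearMapAt ℝ x (s x)) x₀ := by
  rw [continuous_iff_continuousAt]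
  refine forall_congr' fun x₀ => ?_
  rw [FiberBundle.continuousAt_totalSpace]
  simp only [continuous_subtype_val.continuousAt, true_and]
  apply continuousAt_congr
  have hb : ∀ᶠ x : V in 𝓝 x₀, (x : Φ.Domain) ∈
      (trivializationAt (Fin k → ℝ) E (x₀ : Φ.Domain)).baseSet :=
    continuous_subtype_val.continuousAt.eventually
      ((trivializationAt (Fin k → ℝ) E (x₀ : Φ.Domain)).open_baseSet.mem_nhds
        (FiberBundle.mem_baseSet_trivializationAt' _))
  filter_upwards [hb] with x hx
  rw [Trivialization.continuousLinearMapAt_apply,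
    Trivialization.linearMapAt_apply, if_pos hx]

/-- The continuous invariant sections of the bundle over the invariant open set that corresponds to
an open set of the orbit space. -/
def invSections (A : EquivariantStructure (k := k) Φ E) (V : Opens Φ.OrbitSpace) :
    Submodule ℝ (∀ x : {x : Φ.Domain // Φ.orbit x ∈ V}, E x) where
  carrier := {s |
    Continuous (fun x : {x : Φ.Domain // Φ.orbit x ∈ V} =>
      (⟨x, s x⟩ : TotalSpace (Fin k → ℝ) E)) ∧
    ∀ (t : Plane) (x : Φ.Domain) (hx : Φ.orbit x ∈ V) (hx' : Φ.orbit (t +ᵥ x) ∈ V),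
      A.act t x (s ⟨x, hx⟩) = s ⟨t +ᵥ x, hx'⟩}
  add_mem' := by
    rintro s s' ⟨h1, h2⟩ ⟨h1', h2'⟩
    refine ⟨?_, fun t x hx hx' => ?_⟩
    · refine (continuous_section_iff (V := {x | Φ.orbit x ∈ V}) (s + s')).2 fun x₀ => ?_
      have a := (continuous_section_iff (V := {x | Φ.orbit x ∈ V}) s).1 h1 x₀
      have b := (continuous_section_iff (V := {x | Φ.orbit x ∈ V}) s').1 h1' x₀
      refine ContinuousAt.congr (a.add b) (Eventually.of_forall fun x => ?_)
      simp
    · simp [h2 t x hx hx', h2' t x hx hx']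
  zero_mem' := by
    refine ⟨?_, fun t x hx hx' => by simp⟩
    refine (continuous_section_iff (V := {x | Φ.orbit x ∈ V}) 0).2 fun x₀ => ?_
    simpa using continuousAt_const
  smul_mem' := by
    rintro c s ⟨h1, h2⟩
    refine ⟨?_, fun t x hx hx' => ?_⟩
    · refine (continuous_section_iff (V := {x | Φ.orbit x ∈ V}) (c • s)).2 fun x₀ => ?_
      have a := (continuous_section_iff (V := {x | Φ.orbit x ∈ V}) s).1 h1 x₀
      refine ContinuousAt.congr (a.const_smul c) (Eventually.of_forall fun x => ?_)
      simp
    · simp [h2 t x hx hx']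

/-- Restriction of invariant sections. -/
def invRestrict (A : EquivariantStructure (k := k) Φ E) {V W : Opens Φ.OrbitSpace} (h : W ≤ V) :
    invSections A V →ₗ[ℝ] invSections A W where
  toFun s := ⟨fun x => s.1 ⟨x.1, h x.2⟩,
    s.2.1.comp (g := fun x : {x : Φ.Domain // Φ.orbit x ∈ V} =>
        (⟨x, s.1 x⟩ : TotalSpace (Fin k → ℝ) E))
      (f := fun x : {x : Φ.Domain // Φ.orbit x ∈ W} =>
        (⟨x.1, h x.2⟩ : {x : Φ.Domain // Φ.orbit x ∈ V}))
      (Continuous.subtype_mk continuous_subtype_val _),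
    fun t x hx hx' => s.2.2 t x (h hx) (h hx')⟩
  map_add' _ _ := rfl
  map_smul' _ _ := rfl

/-- The presheaf of invariant sections on the orbit space. -/
def invPresheaf (A : EquivariantStructure (k := k) Φ E) :
    TopCat.Presheaf (ModuleCat.{0} ℝ) (TopCat.of Φ.OrbitSpace) where
  obj V := ModuleCat.of ℝ (invSections A V.unop)
  map f := ModuleCat.ofHom (invRestrict A f.unop.le)
  map_id _ := by ext; rfl
  map_comp _ _ := by ext; rfl

theorem invPresheaf_isSheaf (A : EquivariantStructure (k := k) Φ E) : (invPresheaf A).IsSheaf := by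
  rw [TopCat.Presheaf.isSheaf_iff_isSheafUniqueGluing]
  intro ι U sf hsf
  let f : ∀ i, invSections A (U i) := fun i => sf i
  have hcomp : ∀ (i j : ι) (x : Φ.Domain) (hi : Φ.orbit x ∈ U i) (hj : Φ.orbit x ∈ U j),
      (f i).1 ⟨x, hi⟩ = (f j).1 ⟨x, hj⟩ := by
    intro i j x hi hj
    have h := congrArg (fun s : invSections A (U i ⊓ U j) => s.1 ⟨x, hi, hj⟩) (hsf i j)
    exact h
  have hmem : ∀ x : {x : Φ.Domain // Φ.orbit x ∈ iSup U}, ∃ i, Φ.orbit x ∈ U i :=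
    fun x => Opens.mem_iSup.1 x.2
  choose idx hidx using hmem
  let g : ∀ x : {x : Φ.Domain // Φ.orbit x ∈ iSup U}, E x := fun x => (f (idx x)).1 ⟨x, hidx x⟩
  have hg : ∀ (i : ι) (x : Φ.Domain) (hi : Φ.orbit x ∈ U i) (hx : Φ.orbit x ∈ iSup U),
      g ⟨x, hx⟩ = (f i).1 ⟨x, hi⟩ := fun i x hi hx => hcomp _ _ _ _ _
  have hgmem : g ∈ invSections A (iSup U) := by
    refine ⟨?_, fun t x hx hx' => ?_⟩
    · rw [continuous_iff_continuousAt]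
      rintro ⟨x₀, hx₀⟩
      obtain ⟨i, hi⟩ := Opens.mem_iSup.1 hx₀
      have hopen : IsOpen {x : {x : Φ.Domain // Φ.orbit x ∈ iSup U} | Φ.orbit x ∈ U i} :=
        (U i).2.preimage (Φ.continuous_orbit.comp continuous_subtype_val)
      have hon : ContinuousOn (fun x : {x : Φ.Domain // Φ.orbit x ∈ iSup U} =>
          (⟨x, g x⟩ : TotalSpace (Fin k → ℝ) E)) {x | Φ.orbit x ∈ U i} := by
        rw [continuousOn_iff_continuous_domRestrict]
        have h1 := (f i).2.1.comp (g := fun x : {x : Φ.Domain // Φ.orbit x ∈ U i} =>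
            (⟨x, (f i).1 x⟩ : TotalSpace (Fin k → ℝ) E))
          (f := fun x : {x : {x : Φ.Domain // Φ.orbit x ∈ iSup U} | Φ.orbit x ∈ U i} =>
            ⟨x.1.1, x.2⟩)
          ((continuous_subtype_val.comp continuous_subtype_val).subtype_mk fun x => x.2)
        refine h1.congr fun x => ?_
        simp only [Function.comp_apply, Set.domRestrict_apply]
        rw [hg i x.1.1 x.2 x.1.2]
      exact hon.continuousAt (hopen.mem_nhds hi)
    · obtain ⟨i, hi⟩ := Opens.mem_iSup.1 hx
      have hi' : Φ.orbit (t +ᵥ x) ∈ U i := by rw [Φ.orbit_vadd]; exact hi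
      rw [hg i x hi hx, hg i (t +ᵥ x) hi' hx']
      exact (f i).2.2 t x hi hi'
  refine ⟨(⟨g, hgmem⟩ : invSections A (iSup U)), fun i => ?_, fun s hs => ?_⟩
  · change (⟨_, _⟩ : invSections A (U i)) = f i
    apply Subtype.ext
    funext x
    exact hg i x.1 x.2 _
  · let s' : invSections A (iSup U) := s
    change s' = _
    apply Subtype.ext
    funext x
    have h := congrArg (fun r : invSections A (U (idx x)) => r.1 ⟨x.1, hidx x⟩) (hs (idx x))
    exact h

/-- The sheaf of invariant sections on the orbit space. -/
def invSheaf (A : EquivariantStructure (k := k) Φ E) :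
    TopCat.Sheaf (ModuleCat.{0} ℝ) (TopCat.of Φ.OrbitSpace) :=
  ⟨invPresheaf A, invPresheaf_isSheaf A⟩

/-- The global sections functor. -/
def globalSections (Y : TopCat.{0}) : TopCat.Sheaf (ModuleCat.{0} ℝ) Y ⥤ ModuleCat.{0} ℝ :=
  TopCat.Sheaf.forget (ModuleCat.{0} ℝ) Y ⋙ (evaluation _ _).obj (Opposite.op ⊤)

instance (Y : TopCat.{0}) : (globalSections Y).Additive where
  map_add := rfl

/-- The invariant cohomology of an equivariant bundle: the cohomology of the sheaf of its invariant
sections on the orbit space. -/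
def invCohomology (A : EquivariantStructure (k := k) Φ E) (m : ℕ) : ModuleCat.{0} ℝ :=
  ((globalSections (TopCat.of Φ.OrbitSpace)).rightDerived m).obj (invSheaf A)

/-- The invariant Euler characteristic. -/
def invEulerChar (A : EquivariantStructure (k := k) Φ E) : ℤ :=
  ∑ᶠ m : ℕ, (-1) ^ m * (Module.finrank ℝ (invCohomology A m) : ℤ)

end Bundles

/-! ### The characteristic curve -/

namespace ToricFan

variable {n : ℕ} [NeZero n] (Φ : ToricFan n) {k : ℕ}

/-- Bijections `σ i` between the sets of characters at the neighbouring vertices `v i` and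
`v (i + 1)`, such that corresponding characters have the same projection on the edge `ray (i + 1)`
of the fan that separates the two angles. -/
def IsMatching (p : Fin n → Fin k → Plane) (σ : Fin n → Equiv.Perm (Fin k)) : Prop :=
  ∀ i j, dot (p i j) (Φ.ray (i + 1)) = dot (p (i + 1) (σ i j)) (Φ.ray (i + 1))

/-- Shifting the lines through zero. A character `q` at the vertex `v i` lies on a line orthogonal
to `ray i` and on a line orthogonal to `ray (i + 1)`. Each of the two lines that contains zero is
replaced by its parallel on which the product with the edge is `-ε`, and `q` is replaced by the
new point of intersection. -/
def shift (ε : ℝ) (i : Fin n) (q : Plane) : Plane :=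
  q - (ε / cross (Φ.ray i) (Φ.ray (i + 1))) •
    ((if dot q (Φ.ray i) = 0 then (1 : ℝ) else 0) • ((Φ.ray (i + 1)).2, -(Φ.ray (i + 1)).1) +
      (if dot q (Φ.ray (i + 1)) = 0 then (1 : ℝ) else 0) • (-(Φ.ray i).2, (Φ.ray i).1))

theorem dot_shift_left (ε : ℝ) (i : Fin n) (q : Plane) :
    dot (Φ.shift ε i q) (Φ.ray i) = if dot q (Φ.ray i) = 0 then -ε else dot q (Φ.ray i) := by
  have hD := (Φ.cross_pos i).ne'
  rw [shift]
  generalize Φ.ray (i + 1) = v at *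
  generalize Φ.ray i = u at *
  have key : ∀ a b : ℝ, dot (q - (ε / cross u v) • (a • (v.2, -v.1) + b • (-u.2, u.1))) u =
      dot q u - a * ε := by
    intro a b
    have h : ε / cross u v * cross u v = ε := div_mul_cancel₀ ε hD
    generalize ε / cross u v = r at *
    rw [← h]
    simp only [dot, cross, Prod.fst_sub, Prod.snd_sub, Prod.smul_fst, Prod.smul_snd, Prod.fst_add,
      Prod.snd_add, smul_eq_mul]
    ring
  rw [key]
  split_ifs with h <;> simp [h]

theorem dot_shift_right (ε : ℝ) (i : Fin n) (q : Plane) :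
    dot (Φ.shift ε i q) (Φ.ray (i + 1)) =
      if dot q (Φ.ray (i + 1)) = 0 then -ε else dot q (Φ.ray (i + 1)) := by
  have hD := (Φ.cross_pos i).ne'
  rw [shift]
  generalize Φ.ray (i + 1) = v at *
  generalize Φ.ray i = u at *
  have key : ∀ a b : ℝ, dot (q - (ε / cross u v) • (a • (v.2, -v.1) + b • (-u.2, u.1))) v =
      dot q v - b * ε := by
    intro a b
    have h : ε / cross u v * cross u v = ε := div_mul_cancel₀ ε hD
    generalize ε / cross u v = r at *
    rw [← h]
    simp only [dot, cross, Prod.fst_sub, Prod.snd_sub, Prod.smul_fst, Prod.smul_snd, Prod.fst_add,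
      Prod.snd_add, smul_eq_mul]
    ring
  rw [key]
  split_ifs with h <;> simp [h]

end ToricFan

/-- The support of the characteristic curve: the segments that join corresponding characters at
neighbouring vertices. -/
def curveSupport {n : ℕ} [NeZero n] {k : ℕ} (p : Fin n → Fin k → Plane)
    (σ : Fin n → Equiv.Perm (Fin k)) : Set Plane :=
  ⋃ (i : Fin n) (j : Fin k), segment ℝ (p i j) (p (i + 1) (σ i j))

/-- The index (winding number) around zero of the closed piecewise linear `1`-chain made of the
oriented segments from `p i j` to `p (i + 1) (σ i j)`, none of which contains zero: the sum of the
angles in `(-π, π)` under which the segments are seen from zero, divided by `2π`. -/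
def curveIndex {n : ℕ} [NeZero n] {k : ℕ} (p : Fin n → Fin k → Plane)
    (σ : Fin n → Equiv.Perm (Fin k)) : ℝ :=
  (∑ i, ∑ j, (toComplex (p (i + 1) (σ i j)) / toComplex (p i j)).arg) / (2 * Real.pi)

end ToricMorse

end

/-! Both sides equal one count of characters, `weightEuler`: k, minus the number of pairs (edge u_i,
character p) with ⟨p, u_i⟩ ≤ 0, plus the number of pairs (angle, character) for which the products
with both edges are ≤ 0.

Cohomological side. The orbit space is finite: one open orbit, n edges, n vertices, ordered by
inclusion of the sets of vanishing coordinates. Every orbit has a smallest open neighbourhood, its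
star, so a stalk is the space of sections over a star. Embedding a sheaf into the sum of the
skyscrapers on its stalks and repeating this with the cokernel gives a finite injective resolution,
whence χ = ∑ c(o) dim F_o for any coefficients whose sum over the closure of each orbit is 1
(`hasFiniteResolution_of_height`). On the toric polygon c = (-1)^codim works (`sum_eulerCoeff`).

To compute the stalks, the local weight sections at a vertex are spread by the flow to a frame s_j
over the whole star of the vertex (`exists_weightFrame`). On the open orbit an invariant section has
coefficients a_j exp⟨p_j, t⟩ at the translate by t of the base point. It extends to the edges in Z
exactly when a_j = 0 for all j with ⟨p_j, u_l⟩ > 0 for some l in Z (`range_evalBase`). So the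
dimension of a stalk is a number of characters.

Curve side. A segment orthogonal to u on which ⟨·, u⟩ ≠ 0 stays in an open half-plane, so the angle
it subtends is a difference of angles measured from the line of u (`arg_div_eq_lineAngle_sub`).
Regrouped by vertices, these angles give the angle between two consecutive edges, up to a correction
π when the two products have different signs (`lineAngle_sub`). The angles of the fan add up to 2π,
and `curveIndex_eq` is the same count with < in place of ≤. The deformation makes vanishing products
negative, which turns < into ≤. A curve that avoids 0 is the limit of its deformations, and its
index is the limit of theirs.

Matchings exist because u_l fixes a point of the edge l: the frames of the two adjacent vertices
both diagonalise its action on the fibre there, so the eigenvalues exp⟨p, u_l⟩ agree with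
multiplicities. -/

noncomputable section

namespace ToricMorse

/-! ### Injective resolutions built one step at a time -/

section Resolutions
open CategoryTheory.Limits

variable {C : Type*} [Category* C] [Abelian C]

/-- An exact complex of injective objects under an object is an injective resolution. -/
def resolutionOfExact {X : C} (K : CochainComplex C ℕ) (hK : ∀ m, Injective (K.X m))
    (i : X ⟶ K.X 0) (w : i ≫ K.d 0 1 = 0) (hi : Mono i) (h0 : (ShortComplex.mk i (K.d 0 1) w).Exact)
    (hs : ∀ m, (ShortComplex.mk (K.d m (m + 1)) (K.d (m + 1) (m + 2)) (K.d_comp_d _ _ _)).Exact) :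
    InjectiveResolution X where
  cocomplex := K
  injective := hK
  ι := (CochainComplex.fromSingle₀Equiv _ _).symm ⟨i, w⟩
  quasiIso := ⟨fun n => by
    cases n with
    | zero =>
      rw [CochainComplex.quasiIsoAt₀_iff, ShortComplex.quasiIso_iff_of_zeros]
      -- The degree-zero component of the augmentation agrees with `i` only propositionally, so the
      -- claim is stated for every `j` equal to `i`.
      · have key : ∀ (j : X ⟶ K.X 0) (hj : j = i) (hw : j ≫ K.d 0 1 = 0),
            (ShortComplex.mk j (K.d 0 1) hw).Exact ∧ Mono j := by
          rintro j rfl hw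
          exact ⟨h0, hi⟩
        exact key _ (CochainComplex.fromSingle₀Equiv_symm_apply_f_zero i w) _
      · rfl
      · rfl
      · exact K.shape _ _ (by simp)
    | succ n =>
      rw [quasiIsoAt_iff_exactAt]
      · rw [HomologicalComplex.exactAt_iff' _ n (n + 1) (n + 2) (by simp) (by simp)]
        exact hs n
      · apply CochainComplex.exactAt_succ_single_obj⟩

/-- The augmentation of an injective resolution. -/
def aug {X : C} (J : InjectiveResolution X) : X ⟶ J.cocomplex.X 0 := J.ι.f 0

theorem aug_comp_d {X : C} (J : InjectiveResolution X) : aug J ≫ J.cocomplex.d 0 1 = 0 :=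
  J.ι_f_zero_comp_complex_d

instance {X : C} (J : InjectiveResolution X) : Mono (aug J) :=
  inferInstanceAs (Mono (J.ι.f 0))

theorem exact_aug {X : C} (J : InjectiveResolution X) :
    (ShortComplex.mk (aug J) (J.cocomplex.d 0 1) (aug_comp_d J)).Exact :=
  ShortComplex.exact_of_f_is_kernel _ J.isLimitKernelFork

/-- An injective resolution of the cokernel of a monomorphism into an injective object extends to
an injective resolution of the source. -/
def spliceResolution (S : ShortComplex C) (hS : S.ShortExact) (hI : Injective S.X₂)
    (J : InjectiveResolution S.X₃) : InjectiveResolution S.X₁ :=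
  have w : (S.g ≫ aug J) ≫ J.cocomplex.d 0 1 = 0 := by
    rw [Category.assoc, aug_comp_d, comp_zero]
  have w' : S.f ≫ S.g ≫ aug J = 0 := by rw [S.zero_assoc, zero_comp]
  resolutionOfExact (CochainComplex.augment J.cocomplex (S.g ≫ aug J) w)
    (fun m => by
      cases m
      · exact hI
      · exact J.injective _)
    S.f w' hS.mono_f
    (by
      have := hS.mono_f
      let φ : S ⟶ ShortComplex.mk S.f (S.g ≫ aug J) w' :=
        -- Following `S.g` by the monomorphism `aug J` does not change its kernel.
        { τ₁ := 𝟙 _, τ₂ := 𝟙 _, τ₃ := aug J }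
      exact (ShortComplex.exact_iff_of_epi_of_isIso_of_mono φ).1 hS.exact)
    (fun m => by
      cases m with
      | zero =>
        have := hS.epi_g
        let φ : ShortComplex.mk (S.g ≫ aug J) (J.cocomplex.d 0 1) w ⟶
            ShortComplex.mk (aug J) (J.cocomplex.d 0 1) (aug_comp_d J) :=
          -- Preceding `aug J` by the epimorphism `S.g` does not change its image.
          { τ₁ := S.g, τ₂ := 𝟙 _, τ₃ := 𝟙 _ }
        exact (ShortComplex.exact_iff_of_epi_of_isIso_of_mono φ).2 (exact_aug J)
      | succ m => exact J.exact_succ m)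

/-- The object has an injective resolution on which the functor `T` is finite-dimensional in each
degree and zero in large degrees, and has Euler characteristic `c`. -/
def HasFiniteResolution (T : C ⥤ ModuleCat.{0} ℝ) (X : C) (c : ℤ) : Prop :=
  ∃ (I : InjectiveResolution X) (M : ℕ), (∀ m, Module.Finite ℝ (T.obj (I.cocomplex.X m))) ∧
    (∀ m, M ≤ m → Subsingleton (T.obj (I.cocomplex.X m))) ∧
    ∑ m ∈ Finset.range M, (-1) ^ m * (Module.finrank ℝ (T.obj (I.cocomplex.X m)) : ℤ) = c

/-- Splicing moves the resolution of the quotient up by one degree, which reverses the sign of its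
alternating sum. Exactness of `T` plays no role. -/
theorem HasFiniteResolution.splice {T : C ⥤ ModuleCat.{0} ℝ} (S : ShortComplex C)
    (hS : S.ShortExact) (hI : Injective S.X₂) (hf : Module.Finite ℝ (T.obj S.X₂)) {c : ℤ}
    (h : HasFiniteResolution T S.X₃ c) :
    HasFiniteResolution T S.X₁ (Module.finrank ℝ (T.obj S.X₂) - c) := by
  obtain ⟨J, M, h1, h2, h3⟩ := h
  refine ⟨spliceResolution S hS hI J, M + 1, ?_, ?_, ?_⟩
  · rintro (_ | m)
    · exact hf
    · exact h1 m
  · rintro (_ | m) hm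
    · omega
    · exact h2 m (by omega)
  · rw [Finset.sum_range_succ', ← h3, sub_eq_add_neg, add_comm, ← Finset.sum_neg_distrib]
    congr 1
    · simp only [pow_zero, one_mul]; rfl
    · refine Finset.sum_congr rfl fun m _ => ?_
      rw [pow_succ, mul_neg_one, neg_mul]; rfl

theorem hasFiniteResolution_of_isZero (T : C ⥤ ModuleCat.{0} ℝ) [T.Additive] {X : C}
    (h : IsZero X) : HasFiniteResolution T X 0 := by
  have := h.injective
  have hz : ∀ m, IsZero ((InjectiveResolution.self X).cocomplex.X m) := by
    rintro (_ | m)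
    · exact h
    · exact HomologicalComplex.isZero_single_obj_X _ _ _ _ (by simp)
  have hs : ∀ m, Subsingleton (T.obj ((InjectiveResolution.self X).cocomplex.X m)) :=
    fun m => ModuleCat.subsingleton_of_isZero (T.map_isZero (hz m))
  exact ⟨InjectiveResolution.self X, 0, fun m => have := hs m; inferInstance, fun m _ => hs m, rfl⟩

end Resolutions

/-! ### Euler characteristic of a complex and of its homology -/

section EulerCharacteristic

theorem finrank_homology (S : ShortComplex (ModuleCat.{0} ℝ)) [Module.Finite ℝ S.X₂] :
    Module.Finite ℝ S.homology ∧
    (Module.finrank ℝ S.homology : ℤ) = Module.finrank ℝ S.X₂ -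
      Module.finrank ℝ (LinearMap.range S.g.hom) - Module.finrank ℝ (LinearMap.range S.f.hom) := by
  have e : S.homology ≃ₗ[ℝ] (LinearMap.ker S.g.hom ⧸ LinearMap.range S.moduleCatToCycles) :=
    S.moduleCatHomologyIso.toLinearEquiv
  refine ⟨Module.Finite.equiv e.symm, ?_⟩
  have h1 := Submodule.finrank_quotient_add_finrank (LinearMap.range S.moduleCatToCycles)
  have h2 := LinearMap.finrank_range_add_finrank_ker S.g.hom
  have h3 : Module.finrank ℝ (LinearMap.range S.moduleCatToCycles) =
      Module.finrank ℝ (LinearMap.range S.f.hom) := by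
    have : LinearMap.range S.f.hom =
        (LinearMap.range S.moduleCatToCycles).map (LinearMap.ker S.g.hom).subtype := by
      rw [← LinearMap.range_comp]; rfl
    rw [this]
    exact (Submodule.finrank_map_subtype_eq _ _).symm
  rw [e.finrank_eq]
  omega

/-- The rank of a differential. -/
def differentialRank (K : CochainComplex (ModuleCat.{0} ℝ) ℕ) (m : ℕ) : ℕ :=
  Module.finrank ℝ (LinearMap.range (K.d m (m + 1)).hom)

theorem finrank_homology_complex (K : CochainComplex (ModuleCat.{0} ℝ) ℕ)
    (hK : ∀ m, Module.Finite ℝ (K.X m)) (m : ℕ) :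
    Module.Finite ℝ (K.homology m) ∧
    (Module.finrank ℝ (K.homology m) : ℤ) = Module.finrank ℝ (K.X m) -
      differentialRank K m - (if m = 0 then 0 else differentialRank K (m - 1) : ℕ) := by
  have : Module.Finite ℝ (K.sc m).X₂ := hK m
  obtain ⟨h1, h2⟩ := finrank_homology (K.sc m)
  refine ⟨h1, h2.trans ?_⟩
  -- `K.sc m` is indexed by the abstract predecessor and successor of `m`, so the ranks are
  -- identified for a variable index.
  have hg : ∀ j, j = m + 1 → Module.finrank ℝ (LinearMap.range (K.d m j).hom) = differentialRank K m := by rintro j rfl; rfl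
  have hf : ∀ j, j = (ComplexShape.up ℕ).prev m →
      Module.finrank ℝ (LinearMap.range (K.d j m).hom) = if m = 0 then 0 else
        differentialRank K (m - 1) := by
    intro j hj
    rcases m with _ | m
    · rw [K.shape _ _ (by simp)]
      simp
    · rw [CochainComplex.prev_nat_succ] at hj
      subst hj
      simp [differentialRank]
  rw [← hf _ rfl, ← hg _ (CochainComplex.next ℕ m)]
  rfl

/-- The rank of each differential occurs in two consecutive degrees with opposite signs. Only the
rank of the last one survives the truncation. -/
theorem sum_finrank_homology (K : CochainComplex (ModuleCat.{0} ℝ) ℕ)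
    (hK : ∀ m, Module.Finite ℝ (K.X m)) (M : ℕ) :
    ∑ m ∈ Finset.range (M + 1), (-1) ^ m * (Module.finrank ℝ (K.homology m) : ℤ) =
    ∑ m ∈ Finset.range (M + 1), (-1) ^ m * (Module.finrank ℝ (K.X m) : ℤ) -
      (-1) ^ M * differentialRank K M := by
  induction M with
  | zero =>
    simp [(finrank_homology_complex K hK 0).2]
  | succ M ih =>
    rw [Finset.sum_range_succ, ih, Finset.sum_range_succ _ (M + 1),
      (finrank_homology_complex K hK (M + 1)).2]
    simp only [Nat.add_sub_cancel, Nat.succ_ne_zero, if_false, pow_succ]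
    ring

end EulerCharacteristic

/-- Derived functors are the homology of `T` applied to the resolution, and a bounded complex of
finite-dimensional spaces has the Euler characteristic of its homology. -/
theorem HasFiniteResolution.rightDerived {C : Type*} [Category* C] [Abelian C]
    [HasInjectiveResolutions C] {T : C ⥤ ModuleCat.{0} ℝ} [T.Additive] {X : C} {c : ℤ}
    (h : HasFiniteResolution T X c) :
    (∀ m, Module.Finite ℝ ((T.rightDerived m).obj X)) ∧
    (∃ M, ∀ m, M ≤ m → Subsingleton ((T.rightDerived m).obj X)) ∧
    ∑ᶠ m : ℕ, (-1) ^ m * (Module.finrank ℝ ((T.rightDerived m).obj X) : ℤ) = c := by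
  obtain ⟨I, M, h1, h2, h3⟩ := h
  let K := (T.mapHomologicalComplex (ComplexShape.up ℕ)).obj I.cocomplex
  have e : ∀ m, (T.rightDerived m).obj X ≃ₗ[ℝ] K.homology m :=
    fun m => (I.isoRightDerivedObj T m).toLinearEquiv
  have hK : ∀ m, Module.Finite ℝ (K.X m) := h1
  have hfin : ∀ m, Module.Finite ℝ (K.homology m) := fun m => (finrank_homology_complex K hK m).1
  have hX0 : ∀ m, M ≤ m → Module.finrank ℝ (K.X m) = 0 := fun m hm =>
    have : Subsingleton (K.X m) := h2 m hm
    Module.finrank_zero_of_subsingleton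
  have h0 : ∀ m, M ≤ m → Module.finrank ℝ (K.homology m) = 0 := fun m hm => by
    have := (finrank_homology_complex K hK m).2
    rw [hX0 m hm] at this
    omega
  refine ⟨fun m => Module.Finite.equiv (e m).symm, ⟨M, fun m hm => ?_⟩, ?_⟩
  · have := hfin m
    have := Module.finrank_zero_iff.1 (h0 m hm)
    exact (e m).injective.subsingleton
  · simp only [fun m => (e m).finrank_eq]
    -- The sum runs up to degree `M`, one beyond the nonzero terms, so that the leftover rank
    -- belongs to a differential with zero source.
    rw [finsum_eq_sum_of_support_subset (s := Finset.range (M + 1)), sum_finrank_homology K hK M,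
      Finset.sum_range_succ, hX0 M le_rfl, ← h3]
    · have : Subsingleton (K.X M) := h2 M le_rfl
      have hr : differentialRank K M = 0 := by
        have : LinearMap.range (K.d M (M + 1)).hom = ⊥ := by
          rw [LinearMap.range_eq_bot]; exact Subsingleton.elim _ _
        rw [differentialRank, this, finrank_bot]
      rw [hr]
      simp only [Nat.cast_zero, mul_zero, add_zero, sub_zero]
      rfl
    · intro m hm
      by_contra hcon
      simp only [Finset.coe_range, Set.mem_Iio, not_lt] at hcon
      exact hm (by simp [h0 m (by omega)])

/-! ### Sheaves of vector spaces on finite spaces -/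

section FiniteSpaces
open CategoryTheory.Limits

instance injective_moduleCat (V : ModuleCat.{0} ℝ) : Injective V :=
  have := Module.injective_of_isSemisimpleRing ℝ V
  Module.injective_object_of_injective_module ℝ V

variable {Y : TopCat.{0}}

instance hasFiniteBiproducts_sheaf : HasFiniteBiproducts (TopCat.Sheaf (ModuleCat.{0} ℝ) Y) :=
  Abelian.hasFiniteBiproducts

/-- The stalk functor on sheaves of vector spaces. -/
abbrev stalkAt (y : Y) : TopCat.Sheaf (ModuleCat.{0} ℝ) Y ⥤ ModuleCat.{0} ℝ :=
  TopCat.Sheaf.forget (ModuleCat.{0} ℝ) Y ⋙ TopCat.Presheaf.stalkFunctor _ y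

open Classical in
/-- The skyscraper sheaf at `y`, as a functor of its stalk. -/
def skyscraperAt (y : Y) : ModuleCat.{0} ℝ ⥤ TopCat.Sheaf (ModuleCat.{0} ℝ) Y :=
  skyscraperSheafFunctor y

open Classical in
/-- The skyscraper sheaf is right adjoint to the stalk. -/
def stalkAdjunction (y : Y) : stalkAt y ⊣ skyscraperAt y := stalkSkyscraperSheafAdjunction y

/-- A right adjoint of a functor that preserves monomorphisms preserves injective objects, and all
vector spaces are injective. -/
instance injective_skyscraperAt (y : Y) (V : ModuleCat.{0} ℝ) : Injective ((skyscraperAt y).obj V) :=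
  Injective.injective_of_adjoint (stalkAdjunction y) V

theorem finite_finrank_stalk_skyscraperAt (y z : Y) (V : ModuleCat.{0} ℝ) [Module.Finite ℝ V]
    [Decidable (y ⤳ z)] :
    Module.Finite ℝ ((stalkAt z).obj ((skyscraperAt y).obj V)) ∧
    Module.finrank ℝ ((stalkAt z).obj ((skyscraperAt y).obj V)) =
      if y ⤳ z then Module.finrank ℝ V else 0 := by
  classical
  split_ifs with h
  · have e : (stalkAt z).obj ((skyscraperAt y).obj V) ≃ₗ[ℝ] V :=
      (skyscraperPresheafStalkOfSpecializes y V h).toLinearEquiv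
    exact ⟨Module.Finite.equiv e.symm, e.finrank_eq⟩
  · have hz : IsZero ((stalkAt z).obj ((skyscraperAt y).obj V)) :=
      (isZero_zero _).of_iso
        ((skyscraperPresheafStalkOfNotSpecializesIsTerminal y V h).uniqueUpToIso
          (isZero_zero _).isTerminal)
    have := ModuleCat.subsingleton_of_isZero hz
    exact ⟨inferInstance, Module.finrank_zero_of_subsingleton⟩

theorem finite_finrank_globalSections_skyscraperAt (y : Y) (V : ModuleCat.{0} ℝ)
    [Module.Finite ℝ V] :
    Module.Finite ℝ ((globalSections Y).obj ((skyscraperAt y).obj V)) ∧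
    Module.finrank ℝ ((globalSections Y).obj ((skyscraperAt y).obj V)) = Module.finrank ℝ V := by
  classical
  have h : (globalSections Y).obj ((skyscraperAt y).obj V) = V :=
    if_pos (Opens.mem_top y)
  rw [h]
  exact ⟨inferInstance, rfl⟩

theorem finite_finrank_biproduct {C : Type*} [Category* C] [Preadditive C] [HasFiniteBiproducts C]
    {J : Type} [Fintype J] (T : C ⥤ ModuleCat.{0} ℝ) [T.Additive] (f : J → C)
    (hf : ∀ j, Module.Finite ℝ (T.obj (f j))) :
    Module.Finite ℝ (T.obj (⨁ f)) ∧
    Module.finrank ℝ (T.obj (⨁ f)) = ∑ j, Module.finrank ℝ (T.obj (f j)) := by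
  have e : T.obj (⨁ f) ≃ₗ[ℝ] (∀ j, T.obj (f j)) :=
    (T.mapBiproduct f ≪≫ ModuleCat.biproductIsoPi (T.obj ∘ f)).toLinearEquiv
  exact ⟨Module.Finite.equiv e.symm, by rw [e.finrank_eq, Module.finrank_pi_fintype]⟩

/-- The smallest neighbourhood is the last term of the colimit that defines the stalk. -/
theorem germ_bijective (F : TopCat.Presheaf (ModuleCat.{0} ℝ) Y) (y : Y) (U : Opens Y) (hy : y ∈ U)
    (hU : ∀ V : Opens Y, y ∈ V → U ≤ V) : Function.Bijective (F.germ U y hy) := by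
  constructor
  · intro s t hst
    obtain ⟨W, hW, iU, iV, h⟩ := F.germ_eq y hy hy s t hst
    obtain rfl : W = U := le_antisymm iU.le (hU W hW)
    have h1 : iU = 𝟙 _ := Subsingleton.elim _ _
    have h2 : iV = 𝟙 _ := Subsingleton.elim _ _
    rw [h1, h2] at h
    simpa using h
  · intro t
    obtain ⟨V, hV, s, rfl⟩ := F.exists_germ_eq t
    exact ⟨F.map (homOfLE (hU V hV)).op s, F.germ_res_apply (homOfLE (hU V hV)) y hy s⟩

/-- The sections over the smallest neighbourhood of a point are the stalk. -/
def stalkEquiv (F : TopCat.Sheaf (ModuleCat.{0} ℝ) Y) (y : Y) (U : Opens Y) (hy : y ∈ U)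
    (hU : ∀ V : Opens Y, y ∈ V → U ≤ V) :
    F.1.obj (Opposite.op U) ≃ₗ[ℝ] (stalkAt y).obj F :=
  LinearEquiv.ofBijective (TopCat.Presheaf.germ F.1 U y hy).hom (germ_bijective F.1 y U hy hU)

variable [Finite Y]

/-- The product of the skyscraper sheaves on the stalks of a sheaf. -/
def godement (F : TopCat.Sheaf (ModuleCat.{0} ℝ) Y) : TopCat.Sheaf (ModuleCat.{0} ℝ) Y :=
  ⨁ fun y : Y => (skyscraperAt y).obj ((stalkAt y).obj F)

/-- The canonical map from a sheaf to the product of the skyscraper sheaves on its stalks. -/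
def toGodement (F : TopCat.Sheaf (ModuleCat.{0} ℝ) Y) : F ⟶ godement F :=
  biproduct.lift fun y => (stalkAdjunction y).unit.app F

/-- The projection of the product of the skyscraper sheaves to a factor. -/
def godementProjection (F : TopCat.Sheaf (ModuleCat.{0} ℝ) Y) (y : Y) :
    godement F ⟶ (skyscraperAt y).obj ((stalkAt y).obj F) :=
  biproduct.π (fun y : Y => (skyscraperAt y).obj ((stalkAt y).obj F)) y

theorem toGodement_projection (F : TopCat.Sheaf (ModuleCat.{0} ℝ) Y) (y : Y) :
    toGodement F ≫ godementProjection F y = (stalkAdjunction y).unit.app F :=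
  biproduct.lift_π _ _

instance injective_godement (F : TopCat.Sheaf (ModuleCat.{0} ℝ) Y) : Injective (godement F) := by
  unfold godement; infer_instance

/-- It suffices to look at stalks. At `y`, the projection to the factor of `y` followed by the
counit is a left inverse, by the triangle identity. -/
instance mono_toGodement (F : TopCat.Sheaf (ModuleCat.{0} ℝ) Y) : Mono (toGodement F) := by
  have : ∀ y, Mono ((TopCat.Presheaf.stalkFunctor (ModuleCat.{0} ℝ) y).map (toGodement F).1) := by
    intro y
    have h1 : (stalkAt y).map (toGodement F) ≫ (stalkAt y).map (godementProjection F y) ≫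
        (stalkAdjunction y).counit.app _ = 𝟙 _ := by
      rw [← Category.assoc, ← Functor.map_comp, toGodement_projection]
      exact (stalkAdjunction y).left_triangle_components F
    have : Mono ((stalkAt y).map (toGodement F)) :=
      have : Mono ((stalkAt y).map (toGodement F) ≫ (stalkAt y).map (godementProjection F y) ≫
        (stalkAdjunction y).counit.app _) := by rw [h1]; infer_instance
      mono_of_mono _ ((stalkAt y).map (godementProjection F y) ≫ (stalkAdjunction y).counit.app _)
    exact this
  exact TopCat.Presheaf.mono_of_stalk_mono _

/-- The short exact sequence that embeds a sheaf into the product of the skyscraper sheaves on its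
stalks. -/
def godementSequence (F : TopCat.Sheaf (ModuleCat.{0} ℝ) Y) :
    ShortComplex (TopCat.Sheaf (ModuleCat.{0} ℝ) Y) :=
  ShortComplex.mk (toGodement F) (cokernel.π (toGodement F)) (cokernel.condition _)

theorem godementSequence_shortExact (F : TopCat.Sheaf (ModuleCat.{0} ℝ) Y) :
    (godementSequence F).ShortExact where
  exact := ShortComplex.exact_cokernel _
  mono_f := mono_toGodement F
  epi_g := coequalizer.π_epi

theorem finite_finrank_of_shortExact {S : ShortComplex (ModuleCat.{0} ℝ)} (hS : S.ShortExact)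
    [Module.Finite ℝ S.X₁] [Module.Finite ℝ S.X₂] : Module.Finite ℝ S.X₃ ∧
      Module.finrank ℝ S.X₁ + Module.finrank ℝ S.X₃ = Module.finrank ℝ S.X₂ := by
  have := Module.Finite.of_surjective S.g.hom hS.moduleCat_surjective_g
  exact ⟨this, (ModuleCat.free_shortExact_finrank_add hS rfl rfl).symm⟩

/-- Stalks are exact, and the skyscraper at `z` contributes to the stalk at `y` exactly when `y`
lies in the closure of `z`. -/
theorem finite_finrank_stalk_cokernel [Fintype Y] (F : TopCat.Sheaf (ModuleCat.{0} ℝ) Y)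
    (hF : ∀ y : Y, Module.Finite ℝ ((stalkAt y).obj F)) (y : Y) [DecidablePred fun z : Y => z ⤳ y] :
    Module.Finite ℝ ((stalkAt y).obj (godementSequence F).X₃) ∧
    Module.finrank ℝ ((stalkAt y).obj F) + Module.finrank ℝ ((stalkAt y).obj (godementSequence F).X₃)
      = ∑ z : Y, if z ⤳ y then Module.finrank ℝ ((stalkAt z).obj F) else 0 := by
  have h1 : ∀ z : Y, _ := fun z => finite_finrank_stalk_skyscraperAt z y ((stalkAt z).obj F)
  have h2 := finite_finrank_biproduct (stalkAt y)
    (fun z : Y => (skyscraperAt z).obj ((stalkAt z).obj F)) (fun z => (h1 z).1)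
  have hS := (godementSequence_shortExact F).map_of_exact (stalkAt y)
  have : Module.Finite ℝ ((godementSequence F).map (stalkAt y)).X₁ := hF y
  have : Module.Finite ℝ ((godementSequence F).map (stalkAt y)).X₂ := h2.1
  have h3 := finite_finrank_of_shortExact hS
  refine ⟨h3.1, h3.2.trans (h2.2.trans ?_)⟩
  exact Finset.sum_congr rfl fun z _ => (h1 z).2

/-- Induction on a strict bound `r` for the height of the support. Passing to the cokernel Q of F →
`godement F` lowers the bound by one. The formula is inherited because ∑ c(y) (dim F_y + dim Q_y),
rearranged by z, is ∑ dim F_z ∑_{z ⤳ y} c(y) = ∑ dim F_z, the dimension of the global sections of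
`godement F`. -/
theorem hasFiniteResolution_of_height [Fintype Y] [DecidableRel fun z y : Y => z ⤳ y]
    (ht : Y → ℕ) (hht : ∀ z y : Y, z ⤳ y → z ≠ y → ht y < ht z)
    (c : Y → ℤ) (hc : ∀ z : Y, (∑ y, if z ⤳ y then c y else 0) = 1) (r : ℕ) :
    ∀ F : TopCat.Sheaf (ModuleCat.{0} ℝ) Y,
      (∀ y : Y, Module.Finite ℝ ((stalkAt y).obj F)) →
      (∀ y : Y, r ≤ ht y → Module.finrank ℝ ((stalkAt y).obj F) = 0) →
      HasFiniteResolution (globalSections Y) F (∑ y, c y * Module.finrank ℝ ((stalkAt y).obj F)) := by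
  induction r with
  | zero =>
    intro F hF h0
    have hz : IsZero F := by
      refine (TopCat.Sheaf.isZero_iff_stalkFunctor_obj_isZero F).2 fun y => ?_
      have := hF y
      have : Subsingleton ((stalkAt y).obj F) := Module.finrank_zero_iff.1 (h0 y (Nat.zero_le _))
      exact ModuleCat.isZero_of_subsingleton _
    have : (∑ y, c y * (Module.finrank ℝ ((stalkAt y).obj F) : ℤ)) = 0 :=
      Finset.sum_eq_zero fun y _ => by rw [h0 y (Nat.zero_le _), Nat.cast_zero, mul_zero]
    rw [this]
    exact hasFiniteResolution_of_isZero _ hz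
  | succ r ih =>
    intro F hF h0
    have hQ := finite_finrank_stalk_cokernel F hF
    -- At a point `y` of height at least `r`, every other `z ⤳ y` has height above `r`, where F
    -- vanishes. So F and `godement F` have stalks of equal dimension at `y`, and the cokernel has
    -- none.
    have key := ih (godementSequence F).X₃ (fun y => (hQ y).1) (fun y hy => by
      have h1 := (hQ y).2
      rw [Finset.sum_eq_single_of_mem y (Finset.mem_univ _), if_pos (specializes_refl y)] at h1
      · omega
      · intro z _ hzy
        split_ifs with h
        · exact h0 z (lt_of_le_of_lt hy (hht z y h hzy))
        · rfl)
    have hG1 : ∀ z : Y, _ := fun z =>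
      finite_finrank_globalSections_skyscraperAt z ((stalkAt z).obj F)
    have hG := finite_finrank_biproduct (globalSections Y)
      (fun z : Y => (skyscraperAt z).obj ((stalkAt z).obj F)) (fun z => (hG1 z).1)
    have hG2 : Module.finrank ℝ ((globalSections Y).obj (godement F)) =
        ∑ z : Y, Module.finrank ℝ ((stalkAt z).obj F) :=
      hG.2.trans (Finset.sum_congr rfl fun z _ => (hG1 z).2)
    suffices h : (∑ y, c y * (Module.finrank ℝ ((stalkAt y).obj F) : ℤ)) =
        (Module.finrank ℝ ((globalSections Y).obj (godement F)) : ℤ) -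
          ∑ y, c y * (Module.finrank ℝ ((stalkAt y).obj (godementSequence F).X₃) : ℤ) by
      rw [h]
      exact HasFiniteResolution.splice (godementSequence F) (godementSequence_shortExact F)
        (injective_godement F) hG.1 key
    rw [hG2]
    have h3 : ∀ y, (c y * Module.finrank ℝ ((stalkAt y).obj (godementSequence F).X₃) : ℤ) =
        (∑ z, if z ⤳ y then c y * (Module.finrank ℝ ((stalkAt z).obj F) : ℤ) else 0) -
          c y * Module.finrank ℝ ((stalkAt y).obj F) := by
      intro y
      have := congrArg (Nat.cast : ℕ → ℤ) (hQ y).2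
      push_cast at this
      have h4 : (∑ z, if z ⤳ y then c y * (Module.finrank ℝ ((stalkAt z).obj F) : ℤ) else 0) =
          c y * ∑ z, if z ⤳ y then (Module.finrank ℝ ((stalkAt z).obj F) : ℤ) else 0 := by
        rw [Finset.mul_sum]
        exact Finset.sum_congr rfl fun z _ => by split_ifs <;> simp
      rw [h4, ← this]
      ring
    simp only [h3, Finset.sum_sub_distrib]
    rw [Finset.sum_comm]
    have h5 : ∀ z, (∑ y, if z ⤳ y then c y * (Module.finrank ℝ ((stalkAt z).obj F) : ℤ) else 0) =
        Module.finrank ℝ ((stalkAt z).obj F) := by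
      intro z
      have : (∑ y, if z ⤳ y then c y * (Module.finrank ℝ ((stalkAt z).obj F) : ℤ) else 0) =
          (∑ y, if z ⤳ y then c y else 0) * (Module.finrank ℝ ((stalkAt z).obj F) : ℤ) := by
        rw [Finset.sum_mul]
        exact Finset.sum_congr rfl fun z _ => by split_ifs <;> simp
      rw [this, hc, one_mul]
    simp only [h5]
    push_cast
    ring

end FiniteSpaces

/-! ### The orbit space as a finite ordered set -/

theorem cross_self (u : Plane) : cross u u = 0 := by
  simp only [cross]; ring

theorem cross_comm (u v : Plane) : cross v u = -cross u v := by
  simp only [cross]; ring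

namespace ToricFan

variable {n : ℕ} [NeZero n] (Φ : ToricFan n)

theorem add_one_ne (Φ : ToricFan n) (i : Fin n) : i + 1 ≠ i := by
  intro h
  have := Φ.cross_pos i
  rw [h, cross_self] at this
  exact this.false

/-- With `add_one_ne` this says n ≥ 3, which makes the pairs {i, i + 1} distinct. -/
theorem add_one_add_one_ne (Φ : ToricFan n) (i : Fin n) : i + 1 + 1 ≠ i := by
  intro h
  have h1 := Φ.cross_pos i
  have h2 := Φ.cross_pos (i + 1)
  rw [h, cross_comm] at h2
  linarith

/-! ### Zero sets -/

/-- The edges of the fan whose homogeneous coordinates vanish. -/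
def coordZeros (x : Φ.HomogCoord) : Finset (Fin n) := Finset.univ.filter fun j => x.1 j = 0

@[simp] theorem mem_coordZeros {x : Φ.HomogCoord} {j : Fin n} :
    j ∈ Φ.coordZeros x ↔ x.1 j = 0 := by simp [coordZeros]

theorem coordZeros_rescale (c : Fin n → ℝ) (x : Φ.HomogCoord) :
    Φ.coordZeros (Φ.rescale c x) = Φ.coordZeros x := by
  ext j
  rw [mem_coordZeros, mem_coordZeros]
  simp [rescale, (Real.exp_pos _).ne']

/-- The vanishing coordinates of a point of the toric domain. -/
def zeros : Φ.Domain → Finset (Fin n) :=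
  Quotient.lift (s := Φ.homogSetoid) Φ.coordZeros (by
    rintro x y ⟨c, -, rfl⟩
    exact (Φ.coordZeros_rescale c x).symm)

@[simp] theorem zeros_point (x : Φ.HomogCoord) : Φ.zeros (Φ.point x) = Φ.coordZeros x := rfl

theorem exists_point (x : Φ.Domain) : ∃ y, Φ.point y = x := Quotient.exists_rep x

@[simp] theorem zeros_vadd (t : Plane) (x : Φ.Domain) : Φ.zeros (t +ᵥ x) = Φ.zeros x := by
  obtain ⟨y, rfl⟩ := Φ.exists_point x
  rw [← Φ.total_lift t, Φ.vadd_point, zeros_point, coordZeros_rescale, zeros_point]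

/-- The vanishing coordinates of the points of an orbit. -/
def orbitZeros : Φ.OrbitSpace → Finset (Fin n) :=
  Quotient.lift (s := AddAction.orbitRel Plane Φ.Domain) Φ.zeros (by
    rintro x y ⟨t, rfl⟩
    exact Φ.zeros_vadd t y)

@[simp] theorem orbitZeros_orbit (x : Φ.Domain) : Φ.orbitZeros (Φ.orbit x) = Φ.zeros x := rfl

theorem exists_orbit (o : Φ.OrbitSpace) : ∃ x, Φ.orbit x = o := Quotient.exists_rep o

theorem continuous_point : Continuous Φ.point := continuous_quotient_mk'

theorem isOpen_zeros_subset (Z : Finset (Fin n)) : IsOpen {x | Φ.zeros x ⊆ Z} := by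
  have hq : IsQuotientMap Φ.point := isQuotientMap_quotient_mk'
  refine hq.isOpen_preimage.1 ?_
  have : Φ.point ⁻¹' {x | Φ.zeros x ⊆ Z} = ⋂ j ∈ Zᶜ, {x : Φ.HomogCoord | x.1 j ≠ 0} := by
    ext x
    change Φ.coordZeros x ⊆ Z ↔ _
    simp only [Finset.subset_iff, mem_coordZeros, Finset.mem_compl, Set.mem_iInter,
      Set.mem_ofPred_eq]
    exact forall_congr' fun j => not_imp_not.symm
  rw [this]
  refine isOpen_biInter_finset fun j _ => isOpen_ne_fun ?_ continuous_const
  exact (continuous_apply j).comp continuous_subtype_val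

/-- The orbits on which only the coordinates in `Z` may vanish. -/
def star (Z : Finset (Fin n)) : Opens Φ.OrbitSpace where
  carrier := {o | Φ.orbitZeros o ⊆ Z}
  is_open' := (isQuotientMap_quotient_mk'
    (s := AddAction.orbitRel Plane Φ.Domain)).isOpen_preimage.1 (Φ.isOpen_zeros_subset Z)

@[simp] theorem mem_star {Z : Finset (Fin n)} {o : Φ.OrbitSpace} :
    o ∈ Φ.star Z ↔ Φ.orbitZeros o ⊆ Z := Iff.rfl

/-- A flow from one point to another one with more vanishing coordinates. -/
def flowTo (x y : Φ.HomogCoord) (r : ℝ) (l : Fin n) : ℝ :=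
  if x.1 l = 0 then 0 else if y.1 l = 0 then r else Real.log (x.1 l / y.1 l)

/-- Coordinates that vanish only at `y` decay like exp(-r). Those that vanish at neither point are
rescaled at once to their final value. -/
theorem tendsto_rescale_flowTo {x y : Φ.HomogCoord} (h : Φ.coordZeros x ⊆ Φ.coordZeros y) :
    Tendsto (fun r => Φ.rescale (Φ.flowTo x y r) x) atTop (𝓝 y) := by
  refine tendsto_subtype_rng.2 (tendsto_pi_nhds.2 fun l => ?_)
  change Tendsto (fun r => Real.exp (-Φ.flowTo x y r l) * x.1 l) atTop (𝓝 (y.1 l))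
  unfold flowTo
  split_ifs with h1 h2
  · have : y.1 l = 0 := Φ.mem_coordZeros.1 (h (Φ.mem_coordZeros.2 h1))
    rw [h1, this]
    simp
  · rw [h2]
    simpa using (Real.tendsto_exp_neg_atTop_nhds_zero).mul_const (x.1 l)
  · have hx : 0 < x.1 l := lt_of_le_of_ne (x.2.1 l) (Ne.symm h1)
    have hy : 0 < y.1 l := lt_of_le_of_ne (y.2.1 l) (Ne.symm h2)
    have : Real.exp (-Real.log (x.1 l / y.1 l)) * x.1 l = y.1 l := by
      rw [Real.exp_neg, Real.exp_log (div_pos hx hy)]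
      field_simp
    rw [this]
    exact tendsto_const_nhds

theorem exists_tendsto_vadd {x y : Φ.Domain} (h : Φ.zeros x ⊆ Φ.zeros y) :
    ∃ t : ℝ → Plane, Tendsto (fun r => t r +ᵥ x) atTop (𝓝 y) := by
  obtain ⟨x, rfl⟩ := Φ.exists_point x
  obtain ⟨y, rfl⟩ := Φ.exists_point y
  refine ⟨fun r => Φ.total (Φ.flowTo x y r), ?_⟩
  simp only [vadd_point]
  exact (Φ.continuous_point.tendsto y).comp (Φ.tendsto_rescale_flowTo h)

/-- When the zero sets agree, the flow `flowTo` does not depend on its time, so its limit is already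
attained. -/
theorem exists_vadd_eq {x y : Φ.Domain} (h : Φ.zeros x = Φ.zeros y) : ∃ t : Plane, t +ᵥ x = y := by
  obtain ⟨x, rfl⟩ := Φ.exists_point x
  obtain ⟨y, rfl⟩ := Φ.exists_point y
  refine ⟨Φ.total (Φ.flowTo x y 0), ?_⟩
  rw [vadd_point]
  congr 1
  have h2 : (fun r => Φ.rescale (Φ.flowTo x y r) x) = fun _ => Φ.rescale (Φ.flowTo x y 0) x := by
    funext r
    congr 1
    funext l
    unfold flowTo
    split_ifs with h1 h2
    · rfl
    · exact absurd (Φ.mem_coordZeros.1 (by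
        rw [zeros_point, zeros_point] at h
        rw [h]; exact Φ.mem_coordZeros.2 h2)) h1
    · rfl
  have h3 := Φ.tendsto_rescale_flowTo (x := x) (y := y) h.subset
  rw [h2] at h3
  have h4 := ((continuous_subtype_val.tendsto y).comp h3)
  exact Subtype.ext (tendsto_nhds_unique tendsto_const_nhds h4)

theorem orbitZeros_injective : Function.Injective Φ.orbitZeros := by
  intro a b h
  obtain ⟨x, rfl⟩ := Φ.exists_orbit a
  obtain ⟨y, rfl⟩ := Φ.exists_orbit b
  obtain ⟨t, rfl⟩ := Φ.exists_vadd_eq h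
  exact (Φ.orbit_vadd t x).symm

/-- The orbit `a` flows to points of `b`, hence enters the invariant open set over `V`. -/
theorem mem_of_orbitZeros_subset {V : Set Φ.OrbitSpace} (hV : IsOpen V) {a b : Φ.OrbitSpace}
    (hb : b ∈ V) (h : Φ.orbitZeros a ⊆ Φ.orbitZeros b) : a ∈ V := by
  obtain ⟨x, rfl⟩ := Φ.exists_orbit a
  obtain ⟨y, rfl⟩ := Φ.exists_orbit b
  obtain ⟨t, ht⟩ := Φ.exists_tendsto_vadd h
  have h1 := (Φ.continuous_orbit.tendsto y).comp ht
  obtain ⟨r, hr⟩ := (h1.eventually (hV.mem_nhds hb)).exists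
  rwa [Function.comp_apply, orbit_vadd] at hr

theorem specializes_iff {a b : Φ.OrbitSpace} : a ⤳ b ↔ Φ.orbitZeros a ⊆ Φ.orbitZeros b := by
  rw [specializes_iff_forall_open]
  constructor
  · intro h
    exact h (Φ.star (Φ.orbitZeros b)) (Φ.star _).2 (Finset.Subset.refl _)
  · exact fun h V hV hb => Φ.mem_of_orbitZeros_subset hV hb h

/-- This makes the star the smallest neighbourhood of an orbit, so that stalks are spaces of
sections over stars. -/
theorem star_le {V : Opens Φ.OrbitSpace} {a : Φ.OrbitSpace} (ha : a ∈ V) :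
    Φ.star (Φ.orbitZeros a) ≤ V :=
  fun _ hb => Φ.mem_of_orbitZeros_subset V.2 ha hb

/-! ### Cells -/

/-- The point with coordinates `0` in `Z` and `1` elsewhere. -/
def cellCoord (Z : Finset (Fin n)) (hZ : ∃ i, Z ⊆ {i, i + 1}) : Φ.HomogCoord :=
  ⟨fun j => if j ∈ Z then 0 else 1, fun j => by dsimp only; split_ifs <;> norm_num, by
    obtain ⟨i, hi⟩ := hZ
    refine ⟨i, fun j hj => ?_⟩
    by_cases h : j ∈ Z
    · simpa using hi h
    · simp [h] at hj⟩

@[simp] theorem coordZeros_cellCoord (Z : Finset (Fin n)) (hZ : ∃ i, Z ⊆ {i, i + 1}) :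
    Φ.coordZeros (Φ.cellCoord Z hZ) = Z := by
  ext j
  rw [mem_coordZeros]
  by_cases h : j ∈ Z <;> simp [cellCoord, h]

theorem vertex_eq (i : Fin n) :
    Φ.vertex i = Φ.point (Φ.cellCoord {i, i + 1} ⟨i, Finset.Subset.refl _⟩) := by
  unfold vertex
  congr 1
  apply Subtype.ext
  funext j
  simp [cellCoord]

@[simp] theorem zeros_vertex (i : Fin n) : Φ.zeros (Φ.vertex i) = {i, i + 1} := by
  rw [vertex_eq, zeros_point, coordZeros_cellCoord]

theorem exists_zeros_subset (x : Φ.Domain) : ∃ i, Φ.zeros x ⊆ {i, i + 1} := by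
  obtain ⟨x, rfl⟩ := Φ.exists_point x
  obtain ⟨i, hi⟩ := x.2.2
  exact ⟨i, fun j hj => by simpa using hi j (Φ.mem_coordZeros.1 hj)⟩

/-- The cells of the toric domain: the open one, the edges and the vertices, given by their vanishing
coordinates. -/
def cellZeros : Option (Fin n ⊕ Fin n) → Finset (Fin n)
  | none => ∅
  | some (.inl j) => {j}
  | some (.inr i) => {i, i + 1}

theorem cellZeros_subset (a : Option (Fin n ⊕ Fin n)) : ∃ i, cellZeros a ⊆ {i, i + 1} := by
  rcases a with _ | j | i
  · exact ⟨0, by simp [cellZeros]⟩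
  · exact ⟨j, by simp [cellZeros]⟩
  · exact ⟨i, by simp [cellZeros]⟩

/-- The orbit of a cell. -/
def cellOrbit (a : Option (Fin n ⊕ Fin n)) : Φ.OrbitSpace :=
  Φ.orbit (Φ.point (Φ.cellCoord (cellZeros a) (cellZeros_subset a)))

@[simp] theorem orbitZeros_cellOrbit (a : Option (Fin n ⊕ Fin n)) :
    Φ.orbitZeros (Φ.cellOrbit a) = cellZeros a := by
  rw [cellOrbit, orbitZeros_orbit, zeros_point, coordZeros_cellCoord]

theorem pair_subset_pair (Φ : ToricFan n) {i j : Fin n} (h : ({i, i + 1} : Finset (Fin n)) ⊆ {j, j + 1}) : i = j := by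
  have h1 : i ∈ ({j, j + 1} : Finset (Fin n)) := h (by simp)
  have h2 : i + 1 ∈ ({j, j + 1} : Finset (Fin n)) := h (by simp)
  simp only [Finset.mem_insert, Finset.mem_singleton] at h1 h2
  rcases h1 with h1 | h1
  · exact h1
  · rcases h2 with h2 | h2
    · rw [h1] at h2
      exact absurd h2 (Φ.add_one_add_one_ne j)
    · exact add_right_cancel h2

theorem card_pair (Φ : ToricFan n) (i : Fin n) : ({i, i + 1} : Finset (Fin n)).card = 2 :=
  Finset.card_pair (Φ.add_one_ne i).symm

theorem card_cellZeros (Φ : ToricFan n) (a : Option (Fin n ⊕ Fin n)) : (cellZeros a).card =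
    match a with | none => 0 | some (.inl _) => 1 | some (.inr _) => 2 := by
  rcases a with _ | j | i
  · rfl
  · rfl
  · exact Φ.card_pair i

theorem cellZeros_injective (Φ : ToricFan n) : Function.Injective (cellZeros (n := n)) := by
  intro a b h
  have hc := congrArg Finset.card h
  rw [Φ.card_cellZeros, Φ.card_cellZeros] at hc
  rcases a with _ | j | i <;> rcases b with _ | j' | i' <;> simp at hc
  · rfl
  · simp only [cellZeros, Finset.singleton_inj] at h
    rw [h]
  · rw [Φ.pair_subset_pair h.subset]

theorem exists_cellZeros_eq {Z : Finset (Fin n)} (hZ : ∃ i, Z ⊆ {i, i + 1}) :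
    ∃ a, cellZeros a = Z := by
  obtain ⟨i, hi⟩ := hZ
  by_cases h1 : i ∈ Z <;> by_cases h2 : i + 1 ∈ Z
  · refine ⟨some (.inr i), Finset.Subset.antisymm ?_ hi⟩
    simp [cellZeros, Finset.insert_subset_iff, h1, h2]
  · refine ⟨some (.inl i), ?_⟩
    ext j
    simp only [cellZeros, Finset.mem_singleton]
    refine ⟨fun h => h ▸ h1, fun h => ?_⟩
    have := hi h
    simp only [Finset.mem_insert, Finset.mem_singleton] at this
    exact this.resolve_right fun h' => h2 (h' ▸ h)
  · refine ⟨some (.inl (i + 1)), ?_⟩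
    ext j
    simp only [cellZeros, Finset.mem_singleton]
    refine ⟨fun h => h ▸ h2, fun h => ?_⟩
    have := hi h
    simp only [Finset.mem_insert, Finset.mem_singleton] at this
    exact this.resolve_left fun h' => h1 (h' ▸ h)
  · refine ⟨none, ?_⟩
    symm
    refine Finset.eq_empty_of_forall_notMem fun j hj => ?_
    have := hi hj
    simp only [Finset.mem_insert, Finset.mem_singleton] at this
    rcases this with rfl | rfl
    · exact h1 hj
    · exact h2 hj

theorem cellOrbit_bijective : Function.Bijective Φ.cellOrbit := by
  constructor
  · intro a b h
    apply Φ.cellZeros_injective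
    rw [← Φ.orbitZeros_cellOrbit, h, Φ.orbitZeros_cellOrbit]
  · intro o
    obtain ⟨x, rfl⟩ := Φ.exists_orbit o
    obtain ⟨a, ha⟩ := exists_cellZeros_eq (Φ.exists_zeros_subset x)
    refine ⟨a, Φ.orbitZeros_injective ?_⟩
    rw [orbitZeros_cellOrbit, ha, orbitZeros_orbit]

/-- The orbits are the cells. -/
def cellEquiv : Option (Fin n ⊕ Fin n) ≃ Φ.OrbitSpace :=
  Equiv.ofBijective _ Φ.cellOrbit_bijective

instance : Fintype Φ.OrbitSpace := Fintype.ofEquiv _ Φ.cellEquiv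

theorem sum_orbits (f : Φ.OrbitSpace → ℤ) : ∑ o, f o = f (Φ.cellOrbit none) +
    (∑ j, f (Φ.cellOrbit (some (.inl j))) + ∑ i, f (Φ.cellOrbit (some (.inr i)))) := by
  rw [← Φ.cellEquiv.sum_comp, Fintype.sum_option, Fintype.sum_sum_type]
  rfl

/-- The coefficient of an orbit in the Euler characteristic. -/
def eulerCoeff (o : Φ.OrbitSpace) : ℤ := (-1) ^ (Φ.orbitZeros o).card

/-- The closure of an orbit is the whole polygon, a closed edge or a vertex, which gives 1 - n + n,
-1 + 2 and 1. -/
theorem sum_eulerCoeff (o : Φ.OrbitSpace) [DecidablePred fun o' : Φ.OrbitSpace => o ⤳ o'] :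
    (∑ o', if o ⤳ o' then Φ.eulerCoeff o' else 0) = 1 := by
  obtain ⟨a, rfl⟩ := Φ.cellOrbit_bijective.2 o
  simp only [sum_orbits, specializes_iff, eulerCoeff, orbitZeros_cellOrbit, Φ.card_cellZeros]
  rcases a with _ | j | i
  · simp [cellZeros]
  · have h1 : ∀ i, (if j = i ∨ j = i + 1 then (1 : ℤ) else 0) =
        (if j = i then 1 else 0) + (if i + 1 = j then 1 else 0) := by
      intro i
      by_cases ha : j = i
      · subst ha
        simp [(Φ.add_one_ne j)]
      · simp [ha, eq_comm]
    -- The edge `j` has two end points: the vertex `j` and the one whose successor is `j`.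
    have h2 : ∑ i : Fin n, (if i + 1 = j then (1 : ℤ) else 0) = 1 := by
      refine (Equiv.sum_comp (Equiv.addRight (1 : Fin n))
        fun i => if i = j then (1 : ℤ) else 0).trans ?_
      simp
    simp [cellZeros, h1, Finset.sum_add_distrib, h2]
  · have h1 : ∀ j, ¬ (({i, i + 1} : Finset (Fin n)) ⊆ {j}) := by
      intro j h
      have := Finset.card_le_card h
      rw [Φ.card_pair] at this
      simp at this
    have h2 : ∀ j, (({i, i + 1} : Finset (Fin n)) ⊆ {j, j + 1}) ↔ i = j :=
      fun j => ⟨Φ.pair_subset_pair, fun h => h ▸ Finset.Subset.refl _⟩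
    have h3 : ¬ (({i, i + 1} : Finset (Fin n)) ⊆ ∅) := by simp
    simp only [cellZeros, h1, h2, h3]
    simp

theorem finite_and_euler (F : TopCat.Sheaf (ModuleCat.{0} ℝ) (TopCat.of Φ.OrbitSpace))
    (hF : ∀ o : Φ.OrbitSpace,
      Module.Finite ℝ (F.1.obj (Opposite.op (Φ.star (Φ.orbitZeros o))))) :
    HasFiniteResolution (globalSections _) F (∑ o : Φ.OrbitSpace, Φ.eulerCoeff o *
      Module.finrank ℝ (F.1.obj (Opposite.op (Φ.star (Φ.orbitZeros o))))) := by
  classical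
  let e : ∀ o : Φ.OrbitSpace, F.1.obj (Opposite.op (Φ.star (Φ.orbitZeros o))) ≃ₗ[ℝ]
      (stalkAt (Y := TopCat.of Φ.OrbitSpace) o).obj F := fun o =>
    stalkEquiv F o (Φ.star (Φ.orbitZeros o)) (Finset.Subset.refl _) (fun V hV => Φ.star_le hV)
  simp only [fun o => (e o).finrank_eq]
  have : Finite (TopCat.of Φ.OrbitSpace) := inferInstanceAs (Finite Φ.OrbitSpace)
  have : Fintype (TopCat.of Φ.OrbitSpace) := inferInstanceAs (Fintype Φ.OrbitSpace)
  have hcard : ∀ o : Φ.OrbitSpace, (Φ.orbitZeros o).card ≤ n := fun o =>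
    (Finset.card_le_univ _).trans (Fintype.card_fin n).le
  -- The height decreases towards the closure because more coordinates vanish there. All heights are
  -- at most n, so with the bound n + 1 the condition on the support is empty.
  have key := hasFiniteResolution_of_height (Y := TopCat.of Φ.OrbitSpace)
    (fun o => n - (Φ.orbitZeros o).card)
    (fun z y h hne => by
      have h1 : Φ.orbitZeros z ⊂ Φ.orbitZeros y :=
        (Φ.specializes_iff.1 h).ssubset_of_ne fun h' => hne (Φ.orbitZeros_injective h')
      have := Finset.card_lt_card h1
      have := hcard y
      omega)
    Φ.eulerCoeff (fun z => by convert Φ.sum_eulerCoeff z) (n + 1) F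
    (fun o => have := hF o; Module.Finite.equiv (e o)) (fun y hy => by omega)
  convert key

end ToricFan

/-! ### Convergence in vector bundles -/

section VectorBundles

variable {B : Type} [TopologicalSpace B] {k : ℕ}
  {E : B → Type} [∀ x, AddCommGroup (E x)] [∀ x, Module ℝ (E x)]
  [∀ x, TopologicalSpace (E x)] [TopologicalSpace (TotalSpace (Fin k → ℝ) E)]
  [FiberBundle (Fin k → ℝ) E] [VectorBundle ℝ (Fin k → ℝ) E]

/-- The coordinates of a vector in the preferred trivialization at `x₀`. -/
def coordAt (x₀ x : B) : E x →ₗ[ℝ] (Fin k → ℝ) :=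
  (trivializationAt (Fin k → ℝ) E x₀).linearMapAt ℝ x

theorem coordAt_apply {x₀ x : B} (hx : x ∈ (trivializationAt (Fin k → ℝ) E x₀).baseSet) (v : E x) :
    coordAt (k := k) x₀ x v = (trivializationAt (Fin k → ℝ) E x₀ ⟨x, v⟩).2 := by
  rw [coordAt, Trivialization.linearMapAt_apply, if_pos hx]

theorem coordAt_injective {x₀ x : B} (hx : x ∈ (trivializationAt (Fin k → ℝ) E x₀).baseSet) :
    Function.Injective (coordAt (k := k) (E := E) x₀ x) := by
  have : coordAt (k := k) (E := E) x₀ x =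
      ((trivializationAt (Fin k → ℝ) E x₀).linearEquivAt ℝ x hx : E x →ₗ[ℝ] (Fin k → ℝ)) :=
    (trivializationAt (Fin k → ℝ) E x₀).linearMapAt_def_of_mem hx
  rw [this]
  exact LinearEquiv.injective _

variable (E) in
theorem finrank_fiber (x : B) : Module.Finite ℝ (E x) ∧ Module.finrank ℝ (E x) = k := by
  have e := (trivializationAt (Fin k → ℝ) E x).linearEquivAt ℝ x
    (FiberBundle.mem_baseSet_trivializationAt' x)
  exact ⟨Module.Finite.equiv e.symm, by rw [e.finrank_eq]; simp⟩

theorem tendsto_totalSpace_iff {ι : Type*} {l : Filter ι} {f : ι → B} {v : ∀ r, E (f r)} {x₀ : B}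
    {v₀ : E x₀} :
    Tendsto (fun r => (⟨f r, v r⟩ : TotalSpace (Fin k → ℝ) E)) l (𝓝 ⟨x₀, v₀⟩) ↔
      Tendsto f l (𝓝 x₀) ∧ Tendsto (fun r => coordAt (k := k) x₀ (f r) (v r)) l (𝓝 (coordAt (k := k) x₀ x₀ v₀)) := by
  have h0 := FiberBundle.mem_baseSet_trivializationAt' (F := Fin k → ℝ) (E := E) x₀
  rw [(trivializationAt (Fin k → ℝ) E x₀).tendsto_nhds_iff
    ((trivializationAt (Fin k → ℝ) E x₀).mem_source.2 h0)]
  refine and_congr_right fun h => ?_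
  rw [coordAt_apply h0]
  refine tendsto_congr' ?_
  filter_upwards [h.eventually ((trivializationAt (Fin k → ℝ) E x₀).open_baseSet.mem_nhds h0)]
    with r hr
  exact (coordAt_apply hr _).symm

theorem tendsto_totalSpace_smul {ι : Type*} {l : Filter ι} {f : ι → B} {v : ∀ r, E (f r)} {x₀ : B}
    {v₀ : E x₀} {c : ι → ℝ} {c₀ : ℝ} (hc : Tendsto c l (𝓝 c₀))
    (h : Tendsto (fun r => (⟨f r, v r⟩ : TotalSpace (Fin k → ℝ) E)) l (𝓝 ⟨x₀, v₀⟩)) :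
    Tendsto (fun r => (⟨f r, c r • v r⟩ : TotalSpace (Fin k → ℝ) E)) l (𝓝 ⟨x₀, c₀ • v₀⟩) := by
  rw [tendsto_totalSpace_iff] at h ⊢
  refine ⟨h.1, ?_⟩
  simp only [map_smul]
  exact hc.smul h.2

theorem det_coordAt_ne_zero {x₀ x : B} (hx : x ∈ (trivializationAt (Fin k → ℝ) E x₀).baseSet)
    {s : Fin k → E x} (hs : LinearIndependent ℝ s) :
    (Matrix.of fun j => coordAt (k := k) x₀ x (s j)).det ≠ 0 := by
  have h : LinearIndependent ℝ fun j => coordAt (k := k) x₀ x (s j) :=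
    hs.map' (coordAt (k := k) x₀ x) (LinearMap.ker_eq_bot.2 (coordAt_injective hx))
  have := (Matrix.linearIndependent_rows_iff_isUnit (A := Matrix.of fun j => coordAt (k := k) x₀ x (s j))).1 h
  exact ((Matrix.isUnit_iff_isUnit_det _).1 this).ne_zero

theorem tendsto_matrix_coordAt {ι : Type*} {l : Filter ι} {f : ι → B} {s : ∀ r, Fin k → E (f r)}
    {x₀ : B} {s₀ : Fin k → E x₀}
    (hs : ∀ j, Tendsto (fun r => (⟨f r, s r j⟩ : TotalSpace (Fin k → ℝ) E)) l (𝓝 ⟨x₀, s₀ j⟩)) :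
    Tendsto (fun r => Matrix.of fun j => coordAt (k := k) x₀ (f r) (s r j)) l
      (𝓝 (Matrix.of fun j => coordAt (k := k) x₀ x₀ (s₀ j))) :=
  tendsto_pi_nhds.2 fun j => (tendsto_totalSpace_iff.1 (hs j)).2

/-- Linear independence of vectors is an open condition. -/
theorem eventually_linearIndependent {ι : Type*} {l : Filter ι} {f : ι → B}
    {s : ∀ r, Fin k → E (f r)} {x₀ : B} {s₀ : Fin k → E x₀} (h₀ : LinearIndependent ℝ s₀)
    (hs : ∀ j, Tendsto (fun r => (⟨f r, s r j⟩ : TotalSpace (Fin k → ℝ) E)) l (𝓝 ⟨x₀, s₀ j⟩)) :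
    ∀ᶠ r in l, LinearIndependent ℝ (s r) := by
  have h1 := det_coordAt_ne_zero (FiberBundle.mem_baseSet_trivializationAt' x₀) h₀
  have h2 := ((continuous_id.matrix_det (n := Fin k) (R := ℝ)).tendsto _).comp
    (tendsto_matrix_coordAt hs)
  filter_upwards [h2.eventually_ne h1] with r hr
  have h3 := (Matrix.linearIndependent_rows_iff_isUnit
    (A := Matrix.of fun j => coordAt (k := k) x₀ (f r) (s r j))).2
    ((Matrix.isUnit_iff_isUnit_det _).2 (isUnit_iff_ne_zero.2 hr))
  exact LinearIndependent.of_comp (coordAt (k := k) x₀ (f r)) h3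

/-- Cramer's rule: multiplying a M by the adjugate of M gives det(M) a, and both the adjugate and
the determinant are continuous in M. -/
theorem exists_tendsto_of_vecMul {ι : Type*} {l : Filter ι} {M : ι → Matrix (Fin k) (Fin k) ℝ}
    {M₀ : Matrix (Fin k) (Fin k) ℝ} (hM : Tendsto M l (𝓝 M₀)) (h₀ : M₀.det ≠ 0)
    {a : ι → Fin k → ℝ} {w : Fin k → ℝ}
    (hw : Tendsto (fun r => Matrix.vecMul (a r) (M r)) l (𝓝 w)) :
    ∃ b : Fin k → ℝ, Matrix.vecMul b M₀ = w ∧ Tendsto a l (𝓝 b) := by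
  have hdet : Tendsto (fun r => (M r).det) l (𝓝 M₀.det) :=
    ((continuous_id.matrix_det (n := Fin k) (R := ℝ)).tendsto _).comp hM
  have hadj : Tendsto (fun r => (M r).adjugate) l (𝓝 M₀.adjugate) :=
    ((continuous_id.matrix_adjugate (n := Fin k) (R := ℝ)).tendsto _).comp hM
  have hmul : Tendsto (fun r => Matrix.vecMul (Matrix.vecMul (a r) (M r)) (M r).adjugate) l
      (𝓝 (Matrix.vecMul w M₀.adjugate)) := by
    refine tendsto_pi_nhds.2 fun j => ?_
    simp only [Matrix.vecMul, dotProduct]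
    refine tendsto_finsetSum _ fun i _ => ?_
    exact (tendsto_pi_nhds.1 hw i).mul (tendsto_pi_nhds.1 (tendsto_pi_nhds.1 hadj i) j)
  refine ⟨M₀.det⁻¹ • Matrix.vecMul w M₀.adjugate, ?_, ?_⟩
  · rw [Matrix.smul_vecMul, Matrix.vecMul_vecMul, Matrix.adjugate_mul, Matrix.vecMul_smul,
      Matrix.vecMul_one, smul_smul, inv_mul_cancel₀ h₀, one_smul]
  · refine ((hdet.inv₀ h₀).smul hmul).congr' ?_
    filter_upwards [hdet.eventually_ne h₀] with r hr
    rw [Matrix.vecMul_vecMul, Matrix.mul_adjugate, Matrix.vecMul_smul, Matrix.vecMul_one, smul_smul,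
      inv_mul_cancel₀ hr, one_smul]

/-- The coordinates of a convergent vector with respect to a convergent frame converge. -/
theorem exists_tendsto_coefficients {ι : Type*} {l : Filter ι} {f : ι → B}
    {s : ∀ r, Fin k → E (f r)} {x₀ : B} {s₀ : Fin k → E x₀} (h₀ : LinearIndependent ℝ s₀)
    (hs : ∀ j, Tendsto (fun r => (⟨f r, s r j⟩ : TotalSpace (Fin k → ℝ) E)) l (𝓝 ⟨x₀, s₀ j⟩))
    {a : ι → Fin k → ℝ} {v₀ : E x₀}
    (hv : Tendsto (fun r => (⟨f r, ∑ j, a r j • s r j⟩ : TotalSpace (Fin k → ℝ) E)) l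
      (𝓝 ⟨x₀, v₀⟩)) :
    ∃ b : Fin k → ℝ, v₀ = ∑ j, b j • s₀ j ∧ Tendsto a l (𝓝 b) := by
  have hbase := FiberBundle.mem_baseSet_trivializationAt' (F := Fin k → ℝ) (E := E) x₀
  have hcoord : ∀ (x : B) (c : Fin k → ℝ) (t : Fin k → E x),
      coordAt (k := k) x₀ x (∑ j, c j • t j) =
        Matrix.vecMul c (Matrix.of fun j => coordAt (k := k) x₀ x (t j)) := by
    intro x c t
    rw [map_sum, Matrix.vecMul_eq_sum]
    simp only [map_smul]
    rfl
  have hlim := (tendsto_totalSpace_iff.1 hv).2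
  simp only [hcoord] at hlim
  obtain ⟨b, hb, hab⟩ := exists_tendsto_of_vecMul (tendsto_matrix_coordAt hs)
    (det_coordAt_ne_zero hbase h₀) hlim
  refine ⟨b, coordAt_injective hbase ?_, hab⟩
  rw [hcoord, hb]

end VectorBundles

/-! ### Equivariant frames of weight sections -/

theorem dot_add (p s t : Plane) : dot p (s + t) = dot p s + dot p t := by
  simp only [dot, Prod.fst_add, Prod.snd_add]; ring

theorem dot_smul (p : Plane) (c : ℝ) (t : Plane) : dot p (c • t) = c * dot p t := by
  simp only [dot, Prod.smul_fst, Prod.smul_snd, smul_eq_mul]; ring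

theorem dot_zero (p : Plane) : dot p 0 = 0 := by simp [dot]

theorem dot_sum {ι : Type*} (p : Plane) (I : Finset ι) (f : ι → Plane) :
    dot p (∑ i ∈ I, f i) = ∑ i ∈ I, dot p (f i) := by
  classical
  induction I using Finset.induction_on with
  | empty => simp [dot_zero]
  | insert a I ha ih => rw [Finset.sum_insert ha, Finset.sum_insert ha, dot_add, ih]

namespace ToricFan

variable {n : ℕ} [NeZero n] (Φ : ToricFan n)

theorem continuous_rescale (c : Fin n → ℝ) : Continuous (Φ.rescale c) :=
  Continuous.subtype_mk (f := fun (x : Φ.HomogCoord) j => Real.exp (-c j) * x.1 j)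
    (continuous_pi fun j =>
      continuous_const.mul ((continuous_apply j).comp continuous_subtype_val)) _

theorem continuous_vadd (t : Plane) : Continuous fun x : Φ.Domain => t +ᵥ x := by
  have hq : IsQuotientMap Φ.point := isQuotientMap_quotient_mk'
  refine hq.continuous_iff.2 ?_
  have : (fun x : Φ.Domain => t +ᵥ x) ∘ Φ.point = Φ.point ∘ Φ.rescale (Φ.lift t) := by
    funext x
    simp only [Function.comp_apply]
    rw [← Φ.vadd_point, Φ.total_lift]
  rw [this]
  exact Φ.continuous_point.comp (Φ.continuous_rescale _)

end ToricFan

section Frames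

variable {n : ℕ} [NeZero n] {Φ : ToricFan n} {k : ℕ}
  {E : Φ.Domain → Type} [∀ x, AddCommGroup (E x)] [∀ x, Module ℝ (E x)]
  [TopologicalSpace (TotalSpace (Fin k → ℝ) E)]

namespace EquivariantStructure

variable (A : EquivariantStructure (k := k) Φ E)

/-- The action on the total space. -/
def actTotal (t : Plane) (q : TotalSpace (Fin k → ℝ) E) : TotalSpace (Fin k → ℝ) E :=
  ⟨t +ᵥ q.1, A.act t q.1 q.2⟩

theorem actTotal_mk (t : Plane) (x : Φ.Domain) (e : E x) :
    A.actTotal t ⟨x, e⟩ = ⟨t +ᵥ x, A.act t x e⟩ := rfl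

theorem actTotal_zero (q : TotalSpace (Fin k → ℝ) E) : A.actTotal 0 q = q := A.act_zero q.1 q.2

theorem actTotal_add (s t : Plane) (q : TotalSpace (Fin k → ℝ) E) :
    A.actTotal (s + t) q = A.actTotal s (A.actTotal t q) := A.act_add s t q.1 q.2

theorem actTotal_neg_actTotal (t : Plane) (q : TotalSpace (Fin k → ℝ) E) :
    A.actTotal (-t) (A.actTotal t q) = q := by
  rw [← actTotal_add, neg_add_cancel, actTotal_zero]

theorem continuous_actTotal (t : Plane) : Continuous (A.actTotal t) :=
  A.continuous_act.comp (continuous_const.prodMk continuous_id)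

theorem act_injective (t : Plane) (x : Φ.Domain) : Function.Injective (A.act t x) := by
  intro e e' h
  have h1 : A.actTotal t ⟨x, e⟩ = A.actTotal t ⟨x, e'⟩ := by
    simp only [actTotal, h]
  have h2 := congrArg (A.actTotal (-t)) h1
  rw [actTotal_neg_actTotal, actTotal_neg_actTotal] at h2
  exact TotalSpace.mk_inj.1 h2

/-- The compatibility of a local weight section with the action determines how a vector is carried
to all points of the orbit in its domain. -/
theorem act_eq_of_act_eq {p : Plane} {s : ∀ x, E x} {N : Set Φ.Domain}
    (hs : ∀ (t : Plane) (x : Φ.Domain), x ∈ N → t +ᵥ x ∈ N →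
      A.act t x (s x) = Real.exp (dot p t) • s (t +ᵥ x))
    {x : Φ.Domain} {t t' : Plane} (ht : t +ᵥ x ∈ N) (ht' : t' +ᵥ x ∈ N) {e : E x}
    (he : A.act t x e = Real.exp (dot p t) • s (t +ᵥ x)) :
    A.act t' x e = Real.exp (dot p t') • s (t' +ᵥ x) := by
  have hx : (t' - t) +ᵥ (t +ᵥ x) = t' +ᵥ x := by rw [← add_vadd, sub_add_cancel]
  have h1 : A.actTotal t' ⟨x, e⟩ = A.actTotal (t' - t) (A.actTotal t ⟨x, e⟩) := by
    rw [← actTotal_add, sub_add_cancel]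
  have h2 : A.actTotal (t' - t) (A.actTotal t ⟨x, e⟩) =
      ⟨(t' - t) +ᵥ (t +ᵥ x), Real.exp (dot p t') • s ((t' - t) +ᵥ (t +ᵥ x))⟩ := by
    rw [A.actTotal_mk t x e, he, actTotal_mk, map_smul]
    rw [hs (t' - t) (t +ᵥ x) ht (by rw [hx]; exact ht'), smul_smul, ← Real.exp_add, ← dot_add,
      add_sub_cancel]
  rw [h2, hx] at h1
  exact TotalSpace.mk_inj.1 h1

/-- A frame of weight sections over the points whose vanishing coordinates belong to `Z`. -/
structure IsWeightFrame (Z : Finset (Fin n)) (p : Fin k → Plane) (s : Fin k → ∀ x, E x) :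
    Prop where
  continuousAt : ∀ j x, Φ.zeros x ⊆ Z →
    ContinuousAt (fun x => (⟨x, s j x⟩ : TotalSpace (Fin k → ℝ) E)) x
  linearIndependent : ∀ x, Φ.zeros x ⊆ Z → LinearIndependent ℝ fun j => s j x
  act_apply : ∀ t x j, Φ.zeros x ⊆ Z →
    A.act t x (s j x) = Real.exp (dot (p j) t) • s j (t +ᵥ x)

variable {A} in
theorem IsWeightFrame.mono {Z Z' : Finset (Fin n)} {p : Fin k → Plane} {s : Fin k → ∀ x, E x}
    (h : A.IsWeightFrame Z p s) (hZ : Z' ⊆ Z) : A.IsWeightFrame Z' p s where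
  continuousAt j x hx := h.continuousAt j x (hx.trans hZ)
  linearIndependent x hx := h.linearIndependent x (hx.trans hZ)
  act_apply t x j hx := h.act_apply t x j (hx.trans hZ)

variable [∀ x, TopologicalSpace (E x)] [FiberBundle (Fin k → ℝ) E] [VectorBundle ℝ (Fin k → ℝ) E]

theorem act_surjective (t : Plane) (x : Φ.Domain) : Function.Surjective (A.act t x) := by
  obtain ⟨h1, h2⟩ := finrank_fiber (k := k) E x
  obtain ⟨h3, h4⟩ := finrank_fiber (k := k) E (t +ᵥ x)
  exact (LinearMap.injective_iff_surjective_of_finrank_eq_finrank (h2.trans h4.symm)).1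
    (A.act_injective t x)

/-- Local weight sections near a vertex that are linearly independent at the vertex. -/
theorem exists_local_frame {i : Fin n} {p : Fin k → Plane} (hchar : A.HasCharacters i p)
    (hlin : A.IsLinearizableAt i) :
    ∃ (N : Set Φ.Domain) (s : Fin k → ∀ x, E x), IsOpen N ∧ Φ.vertex i ∈ N ∧
      (∀ j, ∀ x ∈ N, ContinuousAt (fun x => (⟨x, s j x⟩ : TotalSpace (Fin k → ℝ) E)) x) ∧
      (∀ x ∈ N, LinearIndependent ℝ fun j => s j x) ∧
      ∀ (j : Fin k) (t : Plane) (x : Φ.Domain), x ∈ N → t +ᵥ x ∈ N →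
        A.act t x (s j x) = Real.exp (dot (p j) t) • s j (t +ᵥ x) := by
  obtain ⟨b, hb⟩ := hchar
  choose N hN s hs0 hscont hsact using fun j => hlin (p j) (b j) (hb j)
  have h1 : ∀ j, ContinuousAt (fun x => (⟨x, s j x⟩ : TotalSpace (Fin k → ℝ) E)) (Φ.vertex i) :=
    fun j => (hscont j).continuousAt (hN j)
  have h2 : ∀ᶠ x in 𝓝 (Φ.vertex i), LinearIndependent ℝ fun j => s j x := by
    refine eventually_linearIndependent (k := k) (f := fun x => x) (s := fun x j => s j x)
      (s₀ := fun j => s j (Φ.vertex i)) ?_ h1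
    simp only [hs0]
    exact b.linearIndependent
  have h3 : ∀ᶠ x in 𝓝 (Φ.vertex i), ∀ j, x ∈ N j := eventually_all.2 hN
  obtain ⟨U, hU, hUo, hUi⟩ := eventually_nhds_iff.1 (h2.and h3)
  refine ⟨U, s, hUo, hUi, fun j x hx => ?_, fun x hx => (hU x hx).1,
    fun j t x hx hx' => hsact j t x ((hU x hx).2 j) ((hU _ hx').2 j)⟩
  exact (hscont j).continuousAt (mem_of_superset (hUo.mem_nhds hx) fun y hy => (hU y hy).2 j)

/-- Every point over the star of the vertex flows into the domain `N` of a local frame. The frame is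
pulled back along this flow, and by `act_eq_of_act_eq` the result does not depend on the chosen
element of the group. -/
theorem exists_weightFrame {i : Fin n} {p : Fin k → Plane} (hchar : A.HasCharacters i p)
    (hlin : A.IsLinearizableAt i) : ∃ s, A.IsWeightFrame {i, i + 1} p s := by
  obtain ⟨N, s, hNo, hNi, hcont, hli, hact⟩ := A.exists_local_frame hchar hlin
  have h1 : ∀ x : Φ.Domain, ∃ t : Plane, Φ.zeros x ⊆ {i, i + 1} → t +ᵥ x ∈ N := by
    intro x
    by_cases hx : Φ.zeros x ⊆ {i, i + 1}
    · obtain ⟨t, ht⟩ := Φ.exists_tendsto_vadd (x := x) (y := Φ.vertex i)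
        (by rw [Φ.zeros_vertex]; exact hx)
      obtain ⟨r, hr⟩ := (ht.eventually (hNo.mem_nhds hNi)).exists
      exact ⟨t r, fun _ => hr⟩
    · exact ⟨0, fun h => absurd h hx⟩
  choose τ hτ using h1
  choose s' hs' using fun (j : Fin k) (x : Φ.Domain) =>
    A.act_surjective (τ x) x (Real.exp (dot (p j) (τ x)) • s j (τ x +ᵥ x))
  have key : ∀ (j : Fin k) (x : Φ.Domain) (t : Plane), Φ.zeros x ⊆ {i, i + 1} → t +ᵥ x ∈ N →
      A.act t x (s' j x) = Real.exp (dot (p j) t) • s j (t +ᵥ x) :=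
    fun j x t hx ht => A.act_eq_of_act_eq (hact j) (hτ x hx) ht (hs' j x)
  refine ⟨s', ⟨fun j x hx => ?_, fun x hx => ?_, fun t x j hx => ?_⟩⟩
  -- Since `N` is open, the element `τ x` also carries nearby points into `N`. Near `x` the new
  -- section is therefore the pullback of the local one by a fixed group element.
  · have hmap : ContinuousAt (fun y : Φ.Domain => τ x +ᵥ y) x := (Φ.continuous_vadd _).continuousAt
    have h2 : ContinuousAt (fun y : Φ.Domain => A.actTotal (-τ x)
        ⟨τ x +ᵥ y, Real.exp (dot (p j) (τ x)) • s j (τ x +ᵥ y)⟩) x := by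
      refine (A.continuous_actTotal _).continuousAt.comp ?_
      have h3 : Tendsto (fun y : Φ.Domain => (⟨τ x +ᵥ y, s j (τ x +ᵥ y)⟩ :
          TotalSpace (Fin k → ℝ) E)) (𝓝 x) (𝓝 ⟨τ x +ᵥ x, s j (τ x +ᵥ x)⟩) :=
        (hcont j _ (hτ x hx)).tendsto.comp hmap
      exact tendsto_totalSpace_smul (c := fun _ => Real.exp (dot (p j) (τ x)))
        tendsto_const_nhds h3
    refine h2.congr ?_
    filter_upwards [hmap.eventually (hNo.mem_nhds (hτ x hx)),
      (Φ.isOpen_zeros_subset {i, i + 1}).mem_nhds hx] with y hy hyZ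
    rw [← key j y (τ x) hyZ hy]
    exact A.actTotal_neg_actTotal (τ x) ⟨y, s' j y⟩
  · refine LinearIndependent.of_comp (A.act (τ x) x) ?_
    have h2 := (hli _ (hτ x hx)).units_smul
      fun j => Units.mk0 (Real.exp (dot (p j) (τ x))) (Real.exp_pos _).ne'
    convert h2 using 1
    funext j
    exact hs' j x
  · have hx' : Φ.zeros (t +ᵥ x) ⊆ {i, i + 1} := by rw [Φ.zeros_vadd]; exact hx
    -- Equivariance is tested after a further flow into `N`, where both sides are known from `key`.
    apply A.act_injective (τ (t +ᵥ x)) (t +ᵥ x)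
    rw [map_smul, key j (t +ᵥ x) _ hx' (hτ _ hx')]
    have h2 : (τ (t +ᵥ x) + t) +ᵥ x = τ (t +ᵥ x) +ᵥ (t +ᵥ x) := add_vadd _ _ _
    have h3 := key j x (τ (t +ᵥ x) + t) hx (by rw [h2]; exact hτ _ hx')
    have h4 : A.actTotal (τ (t +ᵥ x)) (A.actTotal t ⟨x, s' j x⟩) =
        ⟨(τ (t +ᵥ x) + t) +ᵥ x, Real.exp (dot (p j) (τ (t +ᵥ x) + t)) •
          s j ((τ (t +ᵥ x) + t) +ᵥ x)⟩ := by
      rw [← actTotal_add, ← h3]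
      rfl
    rw [h2] at h4
    rw [smul_smul, ← Real.exp_add, ← dot_add, add_comm t]
    exact TotalSpace.mk_inj.1 h4

end EquivariantStructure

end Frames

namespace ToricFan

variable {n : ℕ} [NeZero n] (Φ : ToricFan n)

/-! ### Monomials -/

/-- The monomial on which the group acts by the character `p`. -/
def coordMonomial (p : Plane) (x : Φ.HomogCoord) : ℝ := ∏ l, x.1 l ^ (-dot p (Φ.ray l))

theorem coordMonomial_rescale (p : Plane) (c : Fin n → ℝ) (x : Φ.HomogCoord) :
    Φ.coordMonomial p (Φ.rescale c x) = Real.exp (dot p (Φ.total c)) * Φ.coordMonomial p x := by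
  rw [total, dot_sum, Real.exp_sum, coordMonomial, coordMonomial, ← Finset.prod_mul_distrib]
  refine Finset.prod_congr rfl fun l _ => ?_
  change (Real.exp (-c l) * x.1 l) ^ _ = _
  rw [Real.mul_rpow (Real.exp_pos _).le (x.2.1 l), ← Real.exp_mul, dot_smul, neg_mul_neg]

/-- The monomial with character `p`, as a function on the toric domain. -/
def monomial (p : Plane) : Φ.Domain → ℝ :=
  Quotient.lift (s := Φ.homogSetoid) (Φ.coordMonomial p) (by
    rintro x y ⟨c, hc, rfl⟩
    rw [coordMonomial_rescale, hc, dot_zero, Real.exp_zero, one_mul])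

theorem monomial_point (p : Plane) (x : Φ.HomogCoord) :
    Φ.monomial p (Φ.point x) = Φ.coordMonomial p x := rfl

theorem monomial_vadd (p t : Plane) (x : Φ.Domain) :
    Φ.monomial p (t +ᵥ x) = Real.exp (dot p t) * Φ.monomial p x := by
  obtain ⟨x, rfl⟩ := Φ.exists_point x
  conv_lhs => rw [← Φ.total_lift t]
  rw [vadd_point, monomial_point, coordMonomial_rescale, total_lift, monomial_point]

theorem continuous_coord (l : Fin n) : Continuous fun x : Φ.HomogCoord => x.1 l :=
  (continuous_apply l).comp continuous_subtype_val

/-- Only coordinates in `Z` can vanish on this set, and their exponents -⟨p, u_l⟩ are nonnegative;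
for exponent 0 the factor is the constant 1. -/
theorem continuous_monomial {p : Plane} {Z : Finset (Fin n)}
    (hZ : ∀ l ∈ Z, dot p (Φ.ray l) ≤ 0) :
    Continuous fun x : {x : Φ.Domain | Φ.zeros x ⊆ Z} => Φ.monomial p x := by
  have hq : IsQuotientMap Φ.point := isQuotientMap_quotient_mk'
  refine (hq.restrictPreimage_isOpen (Φ.isOpen_zeros_subset Z)).continuous_iff.2 ?_
  change Continuous fun x : {x : Φ.HomogCoord | Φ.coordZeros x ⊆ Z} => Φ.coordMonomial p x
  unfold coordMonomial
  refine continuous_finsetProd _ fun l _ => continuous_iff_continuousAt.2 fun x => ?_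
  have h1 : ContinuousAt (fun x : {x : Φ.HomogCoord | Φ.coordZeros x ⊆ Z} => x.1.1 l) x :=
    ((Φ.continuous_coord l).comp continuous_subtype_val).continuousAt
  refine h1.rpow_const ?_
  by_cases hl : l ∈ Z
  · exact Or.inr (neg_nonneg.2 (hZ l hl))
  · exact Or.inl fun h => hl (x.2 (Φ.mem_coordZeros.2 h))

/-! ### The base point -/

/-- The base point of the open orbit. -/
def basePoint : Φ.Domain := Φ.point (Φ.cellCoord ∅ ⟨0, by simp⟩)

@[simp] theorem zeros_basePoint : Φ.zeros Φ.basePoint = ∅ := by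
  rw [basePoint, zeros_point, coordZeros_cellCoord]

theorem monomial_basePoint (p : Plane) : Φ.monomial p Φ.basePoint = 1 := by
  rw [basePoint, monomial_point, coordMonomial]
  simp [cellCoord]

/-- The flow in the direction of an edge of the fan ends on the corresponding edge of the toric
domain. -/
theorem tendsto_vadd_basePoint (l : Fin n) :
    Tendsto (fun r : ℝ => (r • Φ.ray l) +ᵥ Φ.basePoint) atTop
      (𝓝 (Φ.point (Φ.cellCoord {l} ⟨l, by simp⟩))) := by
  have h1 := Φ.tendsto_rescale_flowTo (x := Φ.cellCoord ∅ ⟨0, by simp⟩)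
    (y := Φ.cellCoord {l} ⟨l, by simp⟩) (by simp)
  refine ((Φ.continuous_point.tendsto _).comp h1).congr fun r => ?_
  rw [Function.comp_apply, ← vadd_point]
  congr 1
  rw [total, Finset.sum_eq_single l]
  · simp [flowTo, cellCoord]
  · intro j _ hj
    simp [flowTo, cellCoord, hj]
  · simp

end ToricFan

/-! ### Dimensions of the spaces of invariant sections -/

section InvariantSections

variable {n : ℕ} [NeZero n] {Φ : ToricFan n} {k : ℕ}
  {E : Φ.Domain → Type} [∀ x, AddCommGroup (E x)] [∀ x, Module ℝ (E x)]
  [∀ x, TopologicalSpace (E x)] [TopologicalSpace (TotalSpace (Fin k → ℝ) E)]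
  [FiberBundle (Fin k → ℝ) E] [VectorBundle ℝ (Fin k → ℝ) E]
  {A : EquivariantStructure (k := k) Φ E}

/-- The value of an invariant section at the base point. -/
def evalBase (A : EquivariantStructure (k := k) Φ E) (Z : Finset (Fin n)) :
    invSections A (Φ.star Z) →ₗ[ℝ] E Φ.basePoint where
  toFun σ := σ.1 ⟨Φ.basePoint, by simp⟩
  map_add' _ _ := rfl
  map_smul' _ _ := rfl

/-- A weight section times a monomial is an invariant section. -/
def monomialSection {Z : Finset (Fin n)} {p : Fin k → Plane} {s : Fin k → ∀ x, E x}
    (h : A.IsWeightFrame Z p s) (j : Fin k) (hj : ∀ l ∈ Z, dot (p j) (Φ.ray l) ≤ 0) :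
    invSections A (Φ.star Z) :=
  ⟨fun x => Φ.monomial (p j) x.1 • s j x.1, by
    constructor
    · refine continuous_iff_continuousAt.2 fun x => ?_
      exact tendsto_totalSpace_smul (f := fun y : {x : Φ.Domain // Φ.orbit x ∈ Φ.star Z} => y.1)
        (v := fun y => s j y.1) (c := fun y => Φ.monomial (p j) y.1)
        ((Φ.continuous_monomial hj).tendsto x)
        ((h.continuousAt j x.1 x.2).tendsto.comp (continuous_subtype_val.tendsto x))
    · intro t x hx hx'
      simp only
      rw [map_smul, h.act_apply t x j hx, smul_smul, Φ.monomial_vadd, mul_comm]⟩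

theorem evalBase_monomialSection {Z : Finset (Fin n)} {p : Fin k → Plane} {s : Fin k → ∀ x, E x}
    (h : A.IsWeightFrame Z p s) (j : Fin k) (hj : ∀ l ∈ Z, dot (p j) (Φ.ray l) ≤ 0) :
    evalBase A Z (monomialSection h j hj) = s j Φ.basePoint := by
  change Φ.monomial (p j) Φ.basePoint • s j Φ.basePoint = _
  rw [Φ.monomial_basePoint, one_smul]

/-- Invariance fixes the section along the open orbit, with coefficients a_j exp⟨p_j, t⟩. Continuity
of the section at `x`, read in a frame that extends to `x`, makes these coefficients converge. -/
theorem exists_tendsto_invSection {Z : Finset (Fin n)} {p : Fin k → Plane} {s : Fin k → ∀ x, E x}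
    (h : A.IsWeightFrame Z p s) (σ : invSections A (Φ.star Z)) {a : Fin k → ℝ}
    (ha : evalBase A Z σ = ∑ j, a j • s j Φ.basePoint) {t : ℝ → Plane} {x : Φ.Domain}
    (hx : Φ.orbit x ∈ Φ.star Z) (ht : Tendsto (fun r => t r +ᵥ Φ.basePoint) atTop (𝓝 x)) :
    ∃ b : Fin k → ℝ, σ.1 ⟨x, hx⟩ = ∑ j, b j • s j x ∧
      ∀ j, Tendsto (fun r => a j * Real.exp (dot (p j) (t r))) atTop (𝓝 (b j)) := by
  have hbase : Φ.orbit Φ.basePoint ∈ Φ.star Z := by simp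
  have hmem : ∀ r, Φ.orbit (t r +ᵥ Φ.basePoint) ∈ Φ.star Z := fun r => by
    rw [Φ.orbit_vadd]; exact hbase
  have hσ : ∀ r, σ.1 ⟨t r +ᵥ Φ.basePoint, hmem r⟩ =
      ∑ j, (a j * Real.exp (dot (p j) (t r))) • s j (t r +ᵥ Φ.basePoint) := by
    intro r
    rw [← σ.2.2 (t r) Φ.basePoint hbase (hmem r)]
    change A.act _ _ (evalBase A Z σ) = _
    rw [ha, map_sum]
    refine Finset.sum_congr rfl fun j _ => ?_
    rw [map_smul, h.act_apply _ _ _ (by simp), smul_smul]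
  have h1 : Tendsto (fun r => (⟨t r +ᵥ Φ.basePoint, hmem r⟩ :
      {x : Φ.Domain // Φ.orbit x ∈ Φ.star Z})) atTop (𝓝 ⟨x, hx⟩) :=
    tendsto_subtype_rng.2 ht
  have h2 := (σ.2.1.tendsto ⟨x, hx⟩).comp h1
  have h3 : Tendsto (fun r => (⟨t r +ᵥ Φ.basePoint,
      ∑ j, (a j * Real.exp (dot (p j) (t r))) • s j (t r +ᵥ Φ.basePoint)⟩ :
      TotalSpace (Fin k → ℝ) E)) atTop (𝓝 ⟨x, σ.1 ⟨x, hx⟩⟩) := by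
    refine h2.congr fun r => ?_
    rw [Function.comp_apply, hσ]
  obtain ⟨b, hb, hab⟩ := exists_tendsto_coefficients (h.linearIndependent x hx)
    (fun j => (h.continuousAt j x hx).tendsto.comp ht) h3
  exact ⟨b, hb, tendsto_pi_nhds.1 hab⟩

/-- The open orbit is dense, so a section with zero value at the base point has only zero limits. -/
theorem evalBase_injective {Z : Finset (Fin n)} {p : Fin k → Plane} {s : Fin k → ∀ x, E x}
    (h : A.IsWeightFrame Z p s) : Function.Injective (evalBase A Z) := by
  refine (injective_iff_map_eq_zero _).2 fun σ hσ => Subtype.ext (funext fun x => ?_)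
  obtain ⟨t, ht⟩ := Φ.exists_tendsto_vadd (x := Φ.basePoint) (y := x.1) (by simp)
  obtain ⟨b, hb, hlim⟩ := exists_tendsto_invSection h σ (a := 0) (by simp [hσ]) x.2 ht
  have hb0 : ∀ j, b j = 0 := fun j => by
    have := hlim j
    simp only [Pi.zero_apply, zero_mul] at this
    exact (tendsto_nhds_unique tendsto_const_nhds this).symm
  refine hb.trans ?_
  simp [hb0]

/-- If ⟨p_j, u_l⟩ > 0 for some l in `Z`, the flow along u_l makes exp⟨p_j, t⟩ unbounded, which
forces a_j = 0. Every remaining s_j is realised by its product with a monomial. -/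
theorem range_evalBase {Z : Finset (Fin n)} {p : Fin k → Plane} {s : Fin k → ∀ x, E x}
    (h : A.IsWeightFrame Z p s) :
    LinearMap.range (evalBase A Z) = Submodule.span ℝ (Set.range
      fun j : {j : Fin k // ∀ l ∈ Z, dot (p j) (Φ.ray l) ≤ 0} => s j Φ.basePoint) := by
  apply le_antisymm
  · rintro _ ⟨σ, rfl⟩
    have hli := h.linearIndependent Φ.basePoint (by simp)
    have hspan : ⊤ ≤ Submodule.span ℝ (Set.range fun j => s j Φ.basePoint) := by
      obtain ⟨h1, h2⟩ := finrank_fiber (k := k) E Φ.basePoint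
      rw [hli.span_eq_top_of_card_eq_finrank' (by rw [h2, Fintype.card_fin])]
    obtain ⟨a, ha⟩ := (Submodule.mem_span_range_iff_exists_fun ℝ).1
      (hspan (Submodule.mem_top (x := evalBase A Z σ)))
    rw [← ha]
    refine Submodule.sum_mem _ fun j _ => ?_
    by_cases hj : ∀ l ∈ Z, dot (p j) (Φ.ray l) ≤ 0
    · exact Submodule.smul_mem _ _ (Submodule.subset_span ⟨⟨j, hj⟩, rfl⟩)
    · push Not at hj
      obtain ⟨l, hl, hpos⟩ := hj
      obtain ⟨b, -, hlim⟩ := exists_tendsto_invSection h σ ha.symm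
        (by simpa using hl) (Φ.tendsto_vadd_basePoint l)
      have haj : a j = 0 := by
        by_contra hne
        have h1 : Tendsto (fun r : ℝ => Real.exp (dot (p j) (r • Φ.ray l))) atTop atTop := by
          simp only [dot_smul]
          exact Real.tendsto_exp_atTop.comp (tendsto_id.atTop_mul_const hpos)
        have h2 : Tendsto (fun r : ℝ => Real.exp (dot (p j) (r • Φ.ray l))) atTop
            (𝓝 ((a j)⁻¹ * b j)) := by
          refine ((hlim j).const_mul (a j)⁻¹).congr fun r => ?_
          rw [inv_mul_cancel_left₀ hne]
        exact not_tendsto_nhds_of_tendsto_atTop h1 _ h2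
      rw [haj, zero_smul]
      exact Submodule.zero_mem _
  · rw [Submodule.span_le]
    rintro _ ⟨j, rfl⟩
    exact ⟨monomialSection h j.1 j.2, evalBase_monomialSection h j.1 j.2⟩

theorem finite_finrank_invSections {Z : Finset (Fin n)} {p : Fin k → Plane}
    {s : Fin k → ∀ x, E x} (h : A.IsWeightFrame Z p s) :
    Module.Finite ℝ (invSections A (Φ.star Z)) ∧
    Module.finrank ℝ (invSections A (Φ.star Z)) =
      (Finset.univ.filter fun j : Fin k => ∀ l ∈ Z, dot (p j) (Φ.ray l) ≤ 0).card := by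
  obtain ⟨h1, -⟩ := finrank_fiber (k := k) E Φ.basePoint
  refine ⟨Module.Finite.of_injective _ (evalBase_injective h), ?_⟩
  rw [← LinearMap.finrank_range_of_inj (evalBase_injective h), range_evalBase h,
    finrank_span_eq_card, Fintype.card_subtype]
  exact (h.linearIndependent Φ.basePoint (by simp)).comp _ Subtype.val_injective

end InvariantSections

/-! ### Characters on the two sides of an edge -/

theorem exists_perm_of_map_eq {α β : Type*} [Fintype α] {f g : α → β}
    (h : Finset.univ.val.map f = Finset.univ.val.map g) : ∃ σ : Equiv.Perm α, ∀ a, f a = g (σ a) := by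
  classical
  have hc : ∀ b, Fintype.card {a // f a = b} = Fintype.card {a // g a = b} := by
    intro b
    have := congrArg (Multiset.count b) h
    rw [Multiset.count_map, Multiset.count_map] at this
    rw [Fintype.card_subtype, Fintype.card_subtype]
    simpa only [Finset.card_def, Finset.filter_val, eq_comm] using this
  have e : ∀ b, {a // f a = b} ≃ {a // g a = b} := fun b => Fintype.equivOfCardEq (hc b)
  exact ⟨Equiv.ofFiberEquiv e, fun a => (Equiv.ofFiberEquiv_map e a).symm⟩

theorem charpoly_of_eigenbasis {k : ℕ} {V : Type*} [AddCommGroup V] [Module ℝ V]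
    [Module.Finite ℝ V] (hV : Module.finrank ℝ V = k) (L : V →ₗ[ℝ] V) {v : Fin k → V}
    (hv : LinearIndependent ℝ v) {c : Fin k → ℝ} (hL : ∀ j, L (v j) = c j • v j) :
    L.charpoly = ∏ j, (Polynomial.X - Polynomial.C (c j)) := by
  have hcard : Fintype.card (Fin k) = Module.finrank ℝ V := by rw [hV, Fintype.card_fin]
  -- The basis built from an independent family needs a nonempty index type.
  rcases k with _ | k
  · have : Subsingleton V := Module.finrank_zero_iff.1 hV
    have hb : Module.Basis (Fin 0) ℝ V := Module.Basis.empty V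
    rw [← LinearMap.charpoly_toMatrix L hb]
    simp
  · let b := basisOfLinearIndependentOfCardEqFinrank hv hcard
    have hb : ∀ j, b j = v j := fun j => by simp [b]
    rw [← LinearMap.charpoly_toMatrix L b, ← Matrix.charpoly_diagonal]
    congr 1
    ext i j
    rw [LinearMap.toMatrix_apply, hb, hL, ← hb, map_smul, b.repr_self]
    by_cases h : i = j
    · subst h; simp
    · simp [h]

/-- Eigenvalues with multiplicities are the roots of the characteristic polynomial, whichever
eigenbasis is used. -/
theorem exists_perm_eigenvalues {k : ℕ} {V : Type*} [AddCommGroup V] [Module ℝ V]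
    [Module.Finite ℝ V] (hV : Module.finrank ℝ V = k) (L : V →ₗ[ℝ] V) {v w : Fin k → V}
    (hv : LinearIndependent ℝ v) (hw : LinearIndependent ℝ w) {c d : Fin k → ℝ}
    (hc : ∀ j, L (v j) = c j • v j) (hd : ∀ j, L (w j) = d j • w j) :
    ∃ σ : Equiv.Perm (Fin k), ∀ j, c j = d (σ j) := by
  have h := (charpoly_of_eigenbasis hV L hv hc).symm.trans (charpoly_of_eigenbasis hV L hw hd)
  have hr : ∀ c : Fin k → ℝ, (∏ j, (Polynomial.X - Polynomial.C (c j))).roots =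
      Finset.univ.val.map c := by
    intro c
    have := Polynomial.roots_multiset_prod_X_sub_C (Finset.univ.val.map c)
    rw [Multiset.map_map] at this
    exact this
  exact exists_perm_of_map_eq (by rw [← hr, ← hr, h])

section Matching

variable {n : ℕ} [NeZero n] {Φ : ToricFan n} {k : ℕ}
  {E : Φ.Domain → Type} [∀ x, AddCommGroup (E x)] [∀ x, Module ℝ (E x)]
  [∀ x, TopologicalSpace (E x)] [TopologicalSpace (TotalSpace (Fin k → ℝ) E)]
  [FiberBundle (Fin k → ℝ) E] [VectorBundle ℝ (Fin k → ℝ) E]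
  {A : EquivariantStructure (k := k) Φ E}

/-- The edge vector rescales only its own coordinate, which is zero here. -/
theorem ToricFan.ray_vadd_cell (Φ : ToricFan n) (l : Fin n) :
    Φ.ray l +ᵥ Φ.point (Φ.cellCoord {l} ⟨l, by simp⟩) =
      Φ.point (Φ.cellCoord {l} ⟨l, by simp⟩) := by
  have h1 : Φ.total (Pi.single l 1) = Φ.ray l := by
    simp [ToricFan.total, Pi.single_apply, ite_smul]
  conv_lhs => rw [← h1]
  rw [Φ.vadd_point]
  congr 1
  apply Subtype.ext
  funext j
  by_cases h : j = l
  · subst h; simp [ToricFan.rescale, ToricFan.cellCoord]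
  · simp [ToricFan.rescale, ToricFan.cellCoord, h]

/-- Weight frames on both sides of an edge have the same characters on its stabilizer. -/
theorem exists_perm_of_weightFrames {l : Fin n} {p q : Fin k → Plane}
    {s s' : Fin k → ∀ x, E x} (hs : A.IsWeightFrame {l} p s) (hs' : A.IsWeightFrame {l} q s') :
    ∃ σ : Equiv.Perm (Fin k), ∀ j, dot (p j) (Φ.ray l) = dot (q (σ j)) (Φ.ray l) := by
  obtain ⟨x, hx⟩ : ∃ x, x = Φ.point (Φ.cellCoord {l} ⟨l, by simp⟩) := ⟨_, rfl⟩
  have hz : Φ.zeros x ⊆ {l} := by simp [hx]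
  -- The action lands in the fibre over the translated point, which equals `x` only propositionally;
  -- a variable `y` turns it into an endomorphism.
  have key : ∀ (y : Φ.Domain) (L : E x →ₗ[ℝ] E y), y = x →
      (∀ j, L (s j x) = Real.exp (dot (p j) (Φ.ray l)) • s j y) →
      (∀ j, L (s' j x) = Real.exp (dot (q j) (Φ.ray l)) • s' j y) →
      ∃ σ : Equiv.Perm (Fin k), ∀ j,
        Real.exp (dot (p j) (Φ.ray l)) = Real.exp (dot (q (σ j)) (Φ.ray l)) := by
    intro y L hy h1 h2
    subst hy
    obtain ⟨h3, h4⟩ := finrank_fiber (k := k) E y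
    exact exists_perm_eigenvalues h4 L (hs.linearIndependent y hz) (hs'.linearIndependent y hz) h1 h2
  obtain ⟨σ, hσ⟩ := key _ (A.act (Φ.ray l) x) (hx ▸ Φ.ray_vadd_cell l)
    (fun j => hs.act_apply _ _ _ hz) (fun j => hs'.act_apply _ _ _ hz)
  exact ⟨σ, fun j => Real.exp_injective (hσ j)⟩

theorem exists_isMatching {p : Fin n → Fin k → Plane} {s : Fin n → Fin k → ∀ x, E x}
    (hs : ∀ i, A.IsWeightFrame {i, i + 1} (p i) (s i)) : ∃ σ, Φ.IsMatching p σ := by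
  choose σ hσ using fun i => exists_perm_of_weightFrames (l := i + 1)
    ((hs i).mono (by simp)) ((hs (i + 1)).mono (by simp))
  exact ⟨σ, hσ⟩

/-- The combinatorial Euler characteristic of the weights. -/
def weightEuler (Φ : ToricFan n) (p : Fin n → Fin k → Plane) : ℤ :=
  k - ∑ i, ((Finset.univ.filter fun j => dot (p i j) (Φ.ray i) ≤ 0).card : ℤ) +
    ∑ i, ((Finset.univ.filter fun j =>
      dot (p i j) (Φ.ray i) ≤ 0 ∧ dot (p i j) (Φ.ray (i + 1)) ≤ 0).card : ℤ)

/-- The three terms of `weightEuler` come from the open orbit, the edges and the vertices, with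
signs (-1)^codim. -/
theorem hasFiniteResolution_invSheaf {p : Fin n → Fin k → Plane} {s : Fin n → Fin k → ∀ x, E x}
    (hs : ∀ i, A.IsWeightFrame {i, i + 1} (p i) (s i)) :
    HasFiniteResolution (globalSections (TopCat.of Φ.OrbitSpace)) (invSheaf A)
      (weightEuler Φ p) := by
  have h1 : ∀ (i : Fin n) (Z : Finset (Fin n)), Z ⊆ {i, i + 1} →
      Module.Finite ℝ (invSections A (Φ.star Z)) ∧
        Module.finrank ℝ (invSections A (Φ.star Z)) =
          (Finset.univ.filter fun j => ∀ l ∈ Z, dot (p i j) (Φ.ray l) ≤ 0).card :=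
    fun i Z hZ => finite_finrank_invSections ((hs i).mono hZ)
  have h2 : ∀ o : Φ.OrbitSpace, Module.Finite ℝ (invSections A (Φ.star (Φ.orbitZeros o))) := by
    intro o
    obtain ⟨x, rfl⟩ := Φ.exists_orbit o
    obtain ⟨i, hi⟩ := Φ.exists_zeros_subset x
    exact (h1 i _ hi).1
  have h3 := Φ.finite_and_euler (invSheaf A) h2
  convert h3 using 1
  change _ = ∑ o : Φ.OrbitSpace, Φ.eulerCoeff o *
      (Module.finrank ℝ (invSections A (Φ.star (Φ.orbitZeros o))) : ℤ)
  have h4 : ∀ (c : Option (Fin n ⊕ Fin n)) (i : Fin n), ToricFan.cellZeros c ⊆ {i, i + 1} →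
      Module.finrank ℝ (invSections A (Φ.star (Φ.orbitZeros (Φ.cellOrbit c)))) =
        (Finset.univ.filter fun j => ∀ l ∈ ToricFan.cellZeros c, dot (p i j) (Φ.ray l) ≤ 0).card := by
    intro c i hi
    rw [Φ.orbitZeros_cellOrbit]
    exact (h1 i _ hi).2
  rw [Φ.sum_orbits]
  -- An edge `i` is computed in the frame of the vertex `i`. The open orbit can use any frame, since
  -- it imposes no condition on the characters.
  simp only [ToricFan.eulerCoeff, h4 none 0 (by simp [ToricFan.cellZeros]),
    fun i => h4 (some (.inl i)) i (by simp [ToricFan.cellZeros]),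
    fun i => h4 (some (.inr i)) i (by simp [ToricFan.cellZeros])]
  simp only [Φ.orbitZeros_cellOrbit, ToricFan.cellZeros, Φ.card_pair]
  simp [weightEuler]
  ring

end Matching

/-! ### Angles and the index of the curve -/

open scoped ComplexConjugate Real

theorem arg_sub_arg_eq_add {x y : ℂ} (hx : x ≠ 0) (hy : y ≠ 0) :
    ∃ m : ℤ, Complex.arg y - Complex.arg x = Complex.arg (y / x) + 2 * π * m := by
  have h := Complex.arg_div_coe_angle hy hx
  rw [← Real.Angle.coe_sub, eq_comm, Real.Angle.angle_eq_iff_two_pi_dvd_sub] at h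
  obtain ⟨m, hm⟩ := h
  exact ⟨m, by linarith⟩

/-- Both arguments lie in (-π/2, π/2), so their difference is already a principal value. -/
theorem arg_sub_arg_of_re_pos {x y : ℂ} (hx : 0 < x.re) (hy : 0 < y.re) :
    Complex.arg y - Complex.arg x = Complex.arg (y / x) := by
  have hx0 : x ≠ 0 := by rintro rfl; simp at hx
  have hy0 : y ≠ 0 := by rintro rfl; simp at hy
  have h := Complex.arg_div_coe_angle hy0 hx0
  rw [← Real.Angle.coe_sub] at h
  have h1 := abs_lt.1 (Complex.abs_arg_lt_pi_div_two_iff.2 (Or.inl hx))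
  have h2 := abs_lt.1 (Complex.abs_arg_lt_pi_div_two_iff.2 (Or.inl hy))
  rw [← Real.Angle.toReal_coe_eq_self_iff.2 ⟨Complex.neg_pi_lt_arg (y / x), Complex.arg_le_pi _⟩, h,
    Real.Angle.toReal_coe_eq_self_iff.2 ⟨by linarith, by linarith⟩]

theorem toComplex_ne_zero {p : Plane} (h : p ≠ 0) : toComplex p ≠ 0 := by
  contrapose! h
  exact Prod.ext (congrArg Complex.re h) (congrArg Complex.im h)

theorem ne_zero_of_dot_ne_zero {p u : Plane} (h : dot p u ≠ 0) : p ≠ 0 ∧ u ≠ 0 := by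
  constructor <;> rintro rfl <;> simp [dot] at h

theorem ne_zero_of_cross_pos {u v : Plane} (h : 0 < cross u v) : u ≠ 0 ∧ v ≠ 0 := by
  constructor <;> rintro rfl <;> simp [cross] at h

/-- The angle from the line spanned by `u` to the line spanned by `q`, measured in the half-plane
of `u` if `q` lies in it and in the opposite one otherwise. -/
def lineAngle (u q : Plane) : ℝ :=
  Complex.arg ((dot q u : ℂ) * (toComplex q * conj (toComplex u)))

theorem lineAngle_re_pos {u q : Plane} (h : dot q u ≠ 0) :
    0 < ((dot q u : ℂ) * (toComplex q * conj (toComplex u))).re := by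
  have : ((dot q u : ℂ) * (toComplex q * conj (toComplex u))).re = dot q u ^ 2 := by
    simp [toComplex, dot, sq]
  rw [this]
  positivity

/-- Both ends lie in the same open half-plane of `u` or of its opposite, so no multiple of 2π is
lost. -/
theorem arg_div_eq_lineAngle_sub {u q q' : Plane} (h : dot q u ≠ 0) (h' : dot q u = dot q' u) :
    Complex.arg (toComplex q' / toComplex q) = lineAngle u q' - lineAngle u q := by
  rw [lineAngle, lineAngle, arg_sub_arg_of_re_pos (lineAngle_re_pos h)
    (lineAngle_re_pos (h' ▸ h)), ← h']
  have h1 : (dot q u : ℂ) ≠ 0 := Complex.ofReal_ne_zero.2 h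
  have h2 : conj (toComplex u) ≠ 0 :=
    (map_ne_zero _).2 (toComplex_ne_zero (ne_zero_of_dot_ne_zero h).2)
  rw [mul_div_mul_left _ _ h1, mul_div_mul_right _ _ h2]

theorem div_toComplex_im_pos {u v : Plane} (huv : 0 < cross u v) :
    0 < (toComplex v / toComplex u).im := by
  have hu := toComplex_ne_zero (ne_zero_of_cross_pos huv).1
  have h : (toComplex v / toComplex u).im = cross u v / Complex.normSq (toComplex u) := by
    rw [Complex.div_im]
    simp only [toComplex, cross]
    ring
  rw [h]
  exact div_pos huv (Complex.normSq_pos.2 hu)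

/-- The quotient of the two numbers whose arguments are taken is a positive multiple of ±v/u, the
sign being that of ⟨q, u⟩⟨q, v⟩. The bracket is the exclusive or of the two negativity conditions,
and a minus sign costs π because v/u lies in the upper half-plane. -/
theorem lineAngle_sub {u v q : Plane} (huv : 0 < cross u v) (hu : dot q u ≠ 0)
    (hv : dot q v ≠ 0) :
    lineAngle u q - lineAngle v q = Complex.arg (toComplex v / toComplex u) -
      π * ((if dot q u < 0 then 1 else 0) + (if dot q v < 0 then 1 else 0) -
        2 * if dot q u < 0 ∧ dot q v < 0 then 1 else 0) := by
  have hq := toComplex_ne_zero (ne_zero_of_dot_ne_zero hu).1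
  have hu0 := toComplex_ne_zero (ne_zero_of_dot_ne_zero hu).2
  have hv0 := toComplex_ne_zero (ne_zero_of_dot_ne_zero hv).2
  have hnu := Complex.normSq_pos.2 hu0
  have hnv := Complex.normSq_pos.2 hv0
  have hr : 0 < Complex.normSq (toComplex u) / Complex.normSq (toComplex v) / dot q v ^ 2 := by
    positivity
  have e : (dot q u : ℂ) * (toComplex q * conj (toComplex u)) /
      ((dot q v : ℂ) * (toComplex q * conj (toComplex v))) =
      ((Complex.normSq (toComplex u) / Complex.normSq (toComplex v) / dot q v ^ 2 : ℝ) : ℂ) *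
        (((dot q u * dot q v : ℝ) : ℂ) * (toComplex v / toComplex u)) := by
    have h1 : (dot q v : ℂ) ≠ 0 := Complex.ofReal_ne_zero.2 hv
    have h2 : conj (toComplex v) ≠ 0 := (map_ne_zero _).2 hv0
    push_cast [Complex.normSq_eq_conj_mul_self]
    field_simp
  rw [lineAngle, lineAngle, arg_sub_arg_of_re_pos (lineAngle_re_pos hv) (lineAngle_re_pos hu), e,
    Complex.arg_real_mul _ hr]
  have him := div_toComplex_im_pos huv
  rcases lt_or_gt_of_ne hu with h | h <;> rcases lt_or_gt_of_ne hv with h' | h'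
  · rw [Complex.arg_real_mul _ (mul_pos_of_neg_of_neg h h')]
    simp only [h, h', and_self, if_true]
    ring
  · have hn : 0 < -(dot q u * dot q v) := neg_pos.2 (mul_neg_of_neg_of_pos h h')
    rw [← neg_neg (dot q u * dot q v), Complex.ofReal_neg, neg_mul, ← mul_neg,
      Complex.arg_real_mul _ hn, Complex.arg_neg_eq_arg_sub_pi_of_im_pos him]
    simp [h, h'.not_gt]
  · have hn : 0 < -(dot q u * dot q v) := neg_pos.2 (mul_neg_of_pos_of_neg h h')
    rw [← neg_neg (dot q u * dot q v), Complex.ofReal_neg, neg_mul, ← mul_neg,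
      Complex.arg_real_mul _ hn, Complex.arg_neg_eq_arg_sub_pi_of_im_pos him]
    simp [h', h.not_gt]
  · rw [Complex.arg_real_mul _ (mul_pos h h')]
    simp [h.not_gt, h'.not_gt]

/-- The polar angle of `u` on the plane cut along the ray of `w`. -/
def cutAngle (w u : Plane) : ℝ := Complex.arg (-(toComplex u * conj (toComplex w)))

/-- The angle from `u` to `v` lies in (0, π) and polar angles in (-π, π], so the discrepancy is 0 or
2π. It is 2π exactly when the cut is crossed. On the cut the polar angle is π, which is why the
angle contains its first edge and not its second. -/
theorem cutAngle_sub {u v w : Plane} (huv : 0 < cross u v) (hw : w ≠ 0) :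
    (∃ a b : ℝ, 0 < a ∧ 0 ≤ b ∧ w = a • u + b • v) ∧
        Complex.arg (toComplex v / toComplex u) = cutAngle w v - cutAngle w u + 2 * π ∨
      (¬ ∃ a b : ℝ, 0 < a ∧ 0 ≤ b ∧ w = a • u + b • v) ∧
        Complex.arg (toComplex v / toComplex u) = cutAngle w v - cutAngle w u := by
  have hu0 := toComplex_ne_zero (ne_zero_of_cross_pos huv).1
  have hv0 := toComplex_ne_zero (ne_zero_of_cross_pos huv).2
  have hw0 : conj (toComplex w) ≠ 0 := (map_ne_zero _).2 (toComplex_ne_zero hw)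
  have him : ∀ z : Plane, (-(toComplex z * conj (toComplex w))).im = cross z w := by
    intro z
    simp [toComplex, cross]
    ring
  have hcone : (∃ a b : ℝ, 0 < a ∧ 0 ≤ b ∧ w = a • u + b • v) ↔
      0 ≤ cross u w ∧ cross v w < 0 := by
    constructor
    · rintro ⟨a, b, ha, hb, rfl⟩
      have e1 : cross u (a • u + b • v) = b * cross u v := by simp [cross]; ring
      have e2 : cross v (a • u + b • v) = -(a * cross u v) := by simp [cross]; ring
      rw [e1, e2]
      exact ⟨by positivity, neg_neg_of_pos (by positivity)⟩
    · rintro ⟨h1, h2⟩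
      refine ⟨-cross v w / cross u v, cross u w / cross u v, div_pos (neg_pos.2 h2) huv,
        div_nonneg h1 huv.le, ?_⟩
      have hD := huv.ne'
      ext <;> simp only [Prod.fst_add, Prod.snd_add, Prod.smul_fst, Prod.smul_snd,
        smul_eq_mul] <;> field_simp <;> simp only [cross] <;> ring
  obtain ⟨m, hm⟩ := arg_sub_arg_eq_add (neg_ne_zero.2 (mul_ne_zero hu0 hw0))
    (neg_ne_zero.2 (mul_ne_zero hv0 hw0))
  rw [neg_div_neg_eq, mul_div_mul_right _ _ hw0] at hm
  change cutAngle w v - cutAngle w u = _ at hm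
  have hpos : 0 < Complex.arg (toComplex v / toComplex u) := by
    have h := div_toComplex_im_pos huv
    refine lt_of_le_of_ne (Complex.arg_nonneg_iff.2 h.le) fun h' => ?_
    exact h.ne' (Complex.arg_eq_zero_iff.1 h'.symm).2
  have hlt : Complex.arg (toComplex v / toComplex u) < π :=
    Complex.arg_lt_pi_iff.2 (Or.inr (div_toComplex_im_pos huv).ne')
  have hpi := Real.pi_pos
  have hu1 : cutAngle w u ≤ π := Complex.arg_le_pi _
  have hu2 : -π < cutAngle w u := Complex.neg_pi_lt_arg _
  have hv1 : cutAngle w v ≤ π := Complex.arg_le_pi _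
  have hv2 : -π < cutAngle w v := Complex.neg_pi_lt_arg _
  have hu3 : 0 ≤ cutAngle w u ↔ 0 ≤ cross u w := by rw [cutAngle, Complex.arg_nonneg_iff, him]
  have hv3 : cutAngle w v < 0 ↔ cross v w < 0 := by rw [cutAngle, Complex.arg_neg_iff, him]
  generalize Complex.arg (toComplex v / toComplex u) = δ at *
  have hm1 : m < 1 := by
    by_contra! h
    have : (1 : ℝ) ≤ m := by exact_mod_cast h
    nlinarith
  have hm2 : -2 < m := by
    by_contra! h
    have : (m : ℝ) ≤ -2 := by exact_mod_cast h
    nlinarith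
  have hm3 : m = 0 ∨ m = -1 := by omega
  rw [hcone, ← hu3, ← hv3]
  rcases hm3 with rfl | rfl
  · right
    norm_num at hm
    exact ⟨fun h => by linarith [h.1, h.2], hm.symm⟩
  · left
    norm_num at hm
    refine ⟨⟨?_, ?_⟩, by linarith⟩
    · linarith
    · linarith

theorem sum_add_one {n : ℕ} [NeZero n] {M : Type*} [AddCommMonoid M] (f : Fin n → M) :
    ∑ i, f (i + 1) = ∑ i, f i :=
  Equiv.sum_comp (Equiv.addRight 1) f

namespace ToricFan

variable {n : ℕ} [NeZero n] (Φ : ToricFan n) {k : ℕ}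

/-- The angles of a fan add up to the full angle. -/
theorem sum_angles :
    ∑ i, Complex.arg (toComplex (Φ.ray (i + 1)) / toComplex (Φ.ray i)) = 2 * π := by
  have hw : Φ.ray 0 ≠ 0 := (ne_zero_of_cross_pos (Φ.cross_pos 0)).1
  obtain ⟨i₀, hi₀, huniq⟩ := Φ.cover _ hw
  -- Polar angles telescope around the cycle; the jump 2π occurs only in the unique angle that
  -- contains the cut.
  have h : ∀ i, Complex.arg (toComplex (Φ.ray (i + 1)) / toComplex (Φ.ray i)) =
      (cutAngle (Φ.ray 0) (Φ.ray (i + 1)) - cutAngle (Φ.ray 0) (Φ.ray i)) +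
        if i = i₀ then 2 * π else 0 := by
    intro i
    rcases cutAngle_sub (Φ.cross_pos i) hw with ⟨h1, h2⟩ | ⟨h1, h2⟩
    · rw [h2, if_pos (huniq i h1)]
    · rw [h2, if_neg (by rintro rfl; exact h1 hi₀), add_zero]
  rw [Finset.sum_congr rfl fun i _ => h i, Finset.sum_add_distrib, Finset.sum_sub_distrib,
    sum_add_one fun i => cutAngle (Φ.ray 0) (Φ.ray i)]
  simp

/-- The index of a curve that does not cross the rays dual to the edges at zero height. -/
theorem curveIndex_eq {q : Fin n → Fin k → Plane} {σ : Fin n → Equiv.Perm (Fin k)}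
    (hσ : Φ.IsMatching q σ) (hl : ∀ i j, dot (q i j) (Φ.ray i) ≠ 0)
    (hr : ∀ i j, dot (q i j) (Φ.ray (i + 1)) ≠ 0) :
    curveIndex q σ = k - ∑ i, ((Finset.univ.filter fun j => dot (q i j) (Φ.ray i) < 0).card : ℝ) +
      ∑ i, ((Finset.univ.filter fun j =>
        dot (q i j) (Φ.ray i) < 0 ∧ dot (q i j) (Φ.ray (i + 1)) < 0).card : ℝ) := by
  have hperm : ∀ f : Fin n → Plane → ℝ,
      ∑ i, ∑ j, f (i + 1) (q (i + 1) (σ i j)) = ∑ i, ∑ j, f i (q i j) := by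
    intro f
    rw [← sum_add_one fun i => ∑ j, f i (q i j)]
    exact Finset.sum_congr rfl fun i _ => Equiv.sum_comp (σ i) fun j => f (i + 1) (q (i + 1) j)
  -- The end terms of the segments are moved to the next vertex, so that each character is compared
  -- with the two edges of its own angle.
  have h1 : ∑ i, ∑ j, Complex.arg (toComplex (q (i + 1) (σ i j)) / toComplex (q i j)) =
      ∑ i, ∑ j, (lineAngle (Φ.ray i) (q i j) - lineAngle (Φ.ray (i + 1)) (q i j)) := by
    simp only [fun i j => arg_div_eq_lineAngle_sub (hr i j) (hσ i j), Finset.sum_sub_distrib]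
    rw [hperm fun i p => lineAngle (Φ.ray i) p]
  -- Matched characters have equal products with the common edge. The two sums of signs therefore
  -- coincide, and the factor π against 2π leaves each edge counted once.
  have h2 : ∑ i, ∑ j, (if dot (q i j) (Φ.ray (i + 1)) < 0 then (1 : ℝ) else 0) =
      ∑ i, ∑ j, if dot (q i j) (Φ.ray i) < 0 then (1 : ℝ) else 0 := by
    rw [← hperm fun i p => if dot p (Φ.ray i) < 0 then (1 : ℝ) else 0]
    simp only [hσ _ _]
  rw [curveIndex, h1]
  simp only [fun i j => lineAngle_sub (Φ.cross_pos i) (hl i j) (hr i j), Finset.sum_sub_distrib,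
    ← Finset.mul_sum, Finset.sum_add_distrib, h2]
  simp only [Finset.sum_const, Finset.card_univ, Fintype.card_fin, nsmul_eq_mul,
    ← Finset.mul_sum, Φ.sum_angles, Finset.sum_boole]
  have := Real.pi_ne_zero
  field_simp
  ring

theorem isMatching_shift {p : Fin n → Fin k → Plane} {σ : Fin n → Equiv.Perm (Fin k)}
    (hσ : Φ.IsMatching p σ) (ε : ℝ) : Φ.IsMatching (fun i j => Φ.shift ε i (p i j)) σ := by
  intro i j
  change dot (Φ.shift ε i _) _ = dot (Φ.shift ε (i + 1) _) _
  rw [dot_shift_right, dot_shift_left, hσ i j]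

/-- After the shift a product is negative exactly when it was ≤ 0 before, and none vanishes. No
smallness of ε is needed. -/
theorem curveIndex_shift {p : Fin n → Fin k → Plane} {σ : Fin n → Equiv.Perm (Fin k)}
    (hσ : Φ.IsMatching p σ) {ε : ℝ} (hε : 0 < ε) :
    curveIndex (fun i j => Φ.shift ε i (p i j)) σ = (weightEuler Φ p : ℝ) := by
  have hne : ∀ x : ℝ, (if x = 0 then -ε else x) ≠ 0 := by
    intro x
    split_ifs with h
    · exact neg_ne_zero.2 hε.ne'
    · exact h
  have hneg : ∀ x : ℝ, (if x = 0 then -ε else x) < 0 ↔ x ≤ 0 := by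
    intro x
    split_ifs with h
    · simp [h, hε]
    · exact ⟨le_of_lt, fun h' => lt_of_le_of_ne h' h⟩
  rw [Φ.curveIndex_eq (Φ.isMatching_shift hσ ε)
    (fun i j => by rw [dot_shift_left]; exact hne _)
    (fun i j => by rw [dot_shift_right]; exact hne _)]
  simp only [dot_shift_left, dot_shift_right, hneg, weightEuler]
  push_cast
  rfl

theorem tendsto_shift (i : Fin n) (q : Plane) : Tendsto (fun ε => Φ.shift ε i q) (𝓝 0) (𝓝 q) := by
  have h : Continuous fun ε => Φ.shift ε i q := by
    unfold shift
    fun_prop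
  simpa [shift] using h.tendsto 0

end ToricFan

/-! ### The undeformed curve as a limit -/

theorem continuous_toComplex : Continuous toComplex :=
  Complex.equivRealProdCLM.symm.continuous

theorem div_mem_slitPlane {p q : Plane} (h : (0 : Plane) ∉ segment ℝ p q) :
    toComplex p ≠ 0 ∧ toComplex q / toComplex p ∈ Complex.slitPlane := by
  have hp : toComplex p ≠ 0 := toComplex_ne_zero fun h' => h (h' ▸ left_mem_segment ℝ _ _)
  refine ⟨hp, ?_⟩
  by_contra hs
  rw [Complex.mem_slitPlane_iff, not_or, not_lt, not_not] at hs
  obtain ⟨r, hr⟩ : ∃ r : ℝ, r = -(toComplex q / toComplex p).re := ⟨_, rfl⟩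
  have hr0 : 0 ≤ r := by linarith [hs.1]
  have hq : toComplex q = (-r : ℝ) * toComplex p := by
    rw [eq_comm, ← eq_div_iff hp, eq_comm]
    exact Complex.ext (by simp [hr]) (by simpa using hs.2)
  have h1 : q.1 = -r * p.1 := by simpa [toComplex] using congrArg Complex.re hq
  have h2 : q.2 = -r * p.2 := by simpa [toComplex] using congrArg Complex.im hq
  -- If q = -r p with r ≥ 0, then r p + q = 0; dividing by 1 + r gives a convex combination.
  refine h ⟨r / (1 + r), 1 / (1 + r), by positivity, by positivity, by field_simp; ring, ?_⟩
  ext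
  · simp [h1]; field_simp; ring
  · simp [h2]; field_simp; ring

theorem tendsto_curveIndex {n : ℕ} [NeZero n] {k : ℕ} {ι : Type*} {l : Filter ι}
    {q : ι → Fin n → Fin k → Plane} {p : Fin n → Fin k → Plane} {σ : Fin n → Equiv.Perm (Fin k)}
    (hp : (0 : Plane) ∉ curveSupport p σ)
    (hq : ∀ i j, Tendsto (fun a => q a i j) l (𝓝 (p i j))) :
    Tendsto (fun a => curveIndex (q a) σ) l (𝓝 (curveIndex p σ)) := by
  refine Tendsto.div_const (tendsto_finsetSum _ fun i _ => tendsto_finsetSum _ fun j _ => ?_) _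
  have hs : (0 : Plane) ∉ segment ℝ (p i j) (p (i + 1) (σ i j)) := fun h =>
    hp (Set.mem_iUnion₂.2 ⟨i, j, h⟩)
  obtain ⟨h1, h2⟩ := div_mem_slitPlane hs
  exact (Complex.continuousAt_arg h2).tendsto.comp
    (((continuous_toComplex.tendsto _).comp (hq _ _)).div
      ((continuous_toComplex.tendsto _).comp (hq _ _)) h1)

/-- A curve that avoids 0 may still have characters with a vanishing product, so `curveIndex_eq`
does not apply to it directly. Its index is the limit of the indices of its deformations, which are
constant. -/
theorem ToricFan.curveIndex_of_zero_notMem {n : ℕ} [NeZero n] (Φ : ToricFan n) {k : ℕ}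
    {p : Fin n → Fin k → Plane} {σ : Fin n → Equiv.Perm (Fin k)} (hσ : Φ.IsMatching p σ)
    (hp : (0 : Plane) ∉ curveSupport p σ) : curveIndex p σ = (weightEuler Φ p : ℝ) := by
  have h := tendsto_curveIndex (l := 𝓝[>] (0 : ℝ)) hp fun i j =>
    (Φ.tendsto_shift i (p i j)).mono_left nhdsWithin_le_nhds
  refine tendsto_nhds_unique h (tendsto_const_nhds.congr' ?_)
  filter_upwards [self_mem_nhdsWithin] with ε hε
  exact (Φ.curveIndex_shift hσ hε).symm

end ToricMorse

end

theorem lemma4p13 {n : ℕ} [NeZero n] (Φ : ToricMorse.ToricFan n) {k : ℕ}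
    (E : Φ.Domain → Type) [∀ x, AddCommGroup (E x)] [∀ x, Module ℝ (E x)]
    [∀ x, TopologicalSpace (E x)] [TopologicalSpace (TotalSpace (Fin k → ℝ) E)]
    [FiberBundle (Fin k → ℝ) E] [VectorBundle ℝ (Fin k → ℝ) E]
    (A : ToricMorse.EquivariantStructure (k := k) Φ E)
    (p : Fin n → Fin k → ToricMorse.Plane)
    (hchar : ∀ i, A.HasCharacters i (p i))
    (hlin : ∀ i, A.IsLinearizableAt i) :
    (∀ m, Module.Finite ℝ (ToricMorse.invCohomology A m)) ∧
    (∃ M, ∀ m, M ≤ m → Subsingleton (ToricMorse.invCohomology A m)) ∧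
    (∃ σ, Φ.IsMatching p σ) ∧
    ∀ σ, Φ.IsMatching p σ →
      ((0 : ToricMorse.Plane) ∉ ToricMorse.curveSupport p σ →
        ToricMorse.curveIndex p σ = (ToricMorse.invEulerChar A : ℝ)) ∧
      ∀ᶠ ε in 𝓝[>] (0 : ℝ),
        ToricMorse.curveIndex (fun i j => Φ.shift ε i (p i j)) σ =
          (ToricMorse.invEulerChar A : ℝ) := by
  choose s hs using fun i => A.exists_weightFrame (hchar i) (hlin i)
  obtain ⟨h1, h2, h3⟩ := (ToricMorse.hasFiniteResolution_invSheaf hs).rightDerived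
  have h4 : ToricMorse.invEulerChar A = ToricMorse.weightEuler Φ p := h3
  rw [h4]
  refine ⟨h1, h2, ToricMorse.exists_isMatching hs, fun σ hσ => ⟨fun h =>
    Φ.curveIndex_of_zero_notMem hσ h, ?_⟩⟩
  filter_upwards [self_mem_nhdsWithin] with ε hε
  exact Φ.curveIndex_shift hσ hε
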